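/- **Setting.** Let $\mathcal H=\mathcal H_1\otimes\mathcal H_2$ be finite-dimensional, $\rho,\sigma$ states (density matrices) on $\mathcal H$, $\rho_1=\mathrm{Tr}_2\rho$, $\sigma_1=\mathrm{Tr}_2\sigma$; operators on $\mathcal H_1$ are identified with operators on $\mathcal H$ via $X\mapsto X\otimes I$. Real powers of positive semidefinite operators are taken on their support ($A^{-1}$ is the generalized inverse, $A^0$ the support projection). Let $\|A\|_2=(\mathrm{Tr}A^*A)^{1/2}$ and let $\|\cdot\|$ be the operator norm. Let $f:(0,\infty)\to\mathbb R$ be operator monotone decreasing with $f(1)=0$, with canonical representation $$f(x)=ax+b+\int_0^\infty\Big(\frac1{t+x}-\frac t{t^2+1}\Big)d\mu_f(t),\qquad a\le 0,\ b\in\mathbb R,\ \int_0^\infty\frac{d\mu_f(t)}{t^2+1}<\infty,$$ where $\mu_f$ is a positive measure on the half-line. Assume $f$ is regular: $\mu_f$ is absolutely continuous with respect to Lebesgue measure and for all $S,T>0$ there is a finite constant $C'$ with $dt\le C'\,d\mu_f(t)$ on $[1/S,T]$. For $\beta\in(0,1)$ and $T>0$ put $(T_L,T_R)=(T,T^{\beta/(1-\beta)})$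 if $\beta\le\frac12$ and $(T_L,T_R)=(T^{(1-\beta)/\beta},T)$ if $\beta\ge\frac12$, and let $C^f_{T,\beta}$ be the least constant with $dt\le C^f_{T,\beta}\,d\mu_f(t)$ on $[T_L^{-1},T_R]$ (it is $0$ if this interval is empty). The quasi-relative entropy is $S_f^K(\rho\|\sigma)=\mathrm{Tr}\big(\sqrt\rho K^*f(\Delta_{\sigma,\rho})(K\sqrt\rho)\big)$, where $\Delta_{\sigma,\rho}(X)=\sigma X\rho^{-1}$. Assume it is finite, that is, either $f(0):=\lim_{x\downarrow0}f(x)$ is finite, or $\ker\sigma\subseteq\ker(\rho K^*)$ (for example, $\sigma$ is invertible). **Statement.** Let $\beta\in(0,1)$, $f$ as above, $K=K_1\otimes V$ with $V$ unitary, and suppose $C^f_{T,\beta}\le C\,T^{2c}$ for all $T>0$, for some $c,C>0$. Put $$\alpha(\beta)=\begin{cases}\dfrac{\beta(1-\beta)}{1+2c(1-\beta)},&\beta\le\frac12,\\[2mm]\dfrac12\,\dfrac{1-\beta}{1+c},&\beta\ge\frac12,\end{cases}\qquad M(r)=\frac{\sin\beta\pi}{\pi}\left(2\|K\|\Big(\frac1\beta+\frac1{r(1-\beta)}\Big)+\sqrt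 C\right).$$ Then $S_f^K(\rho\|\sigma)-S_f^{K_1}(\rho_1\|\sigma_1)\ge0$, and $$\big\|\sigma_1^{\beta}K\rho_1^{-\beta}\rho^{1/2}-\sigma^{\beta}K\rho^{1/2-\beta}\big\|_2\le M\,\big(S_f^K(\rho\|\sigma)-S_f^{K_1}(\rho_1\|\sigma_1)\big)^{\alpha(\beta)}$$ where the explicit constant $M$ depends only on the following data: 1. if $\rho$ is invertible, $M=M(r)$ with $r$ the smallest eigenvalue of $\rho$; 2. for every state $\rho$, $M=M(r)$ with $r$ the smaller of the smallest non-zero eigenvalue of $\rho$ and that of $\rho_1$. In particular, for $\beta=\frac12$ and $\rho$ invertible (with $M$ as in 1), $$\big\|\sigma_1^{1/2}K\rho_1^{-1/2}\rho^{1/2}-\sigma^{1/2}K\big\|_2\le M\,\big(S_f^K(\rho\|\sigma)-S_f^{K_1}(\rho_1\|\sigma_1)\big)^{\frac1{4(1+c)}}.$$ -/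

import Mathlib

open MeasureTheory Matrix
open scoped Kronecker ENNReal NNReal ComplexOrder Topology

noncomputable section

namespace QRE

/-! ### Operator monotone decreasing functions on `(0, ∞)` and their representing measures -/

/-- `f` is operator monotone decreasing on `(0, ∞)`: whenever `A`, `B` are self-adjoint operators on
a Hilbert space with spectrum in `(0, ∞)` and `B ≤ A`, one has `f(A) ≤ f(B)`. -/
def IsOperatorMonotoneDecreasing (f : ℝ → ℝ) : Prop :=
  ∀ (H : Type) [NormedAddCommGroup H] [InnerProductSpace ℂ H] [CompleteSpace H] (A B : H →L[ℂ] H),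
    IsSelfAdjoint A → IsSelfAdjoint B → spectrum ℝ A ⊆ Set.Ioi 0 → spectrum ℝ B ⊆ Set.Ioi 0 →
    B ≤ A → cfc f A ≤ cfc f B

/-- `(a, b, μ)` is the data of the canonical (Loewner) integral representation
`f(x) = a x + b + ∫_0^∞ (1/(t+x) - t/(t²+1)) dμ(t)`, `x > 0`, with `a ≤ 0` and `μ` a positive
measure on the half-line with `∫ 1/(t²+1) dμ(t) < ∞`. -/
structure IsCanonicalRep (f : ℝ → ℝ) (a b : ℝ) (μ : Measure ℝ) : Prop where
  nonpos : a ≤ 0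
  support : μ (Set.Iio 0) = 0
  integrable : Integrable (fun t : ℝ => 1 / (t ^ 2 + 1)) μ
  eq : ∀ x : ℝ, 0 < x → f x = a * x + b + ∫ t, (1 / (t + x) - t / (t ^ 2 + 1)) ∂μ

open Classical in
/-- The measure `μ_f` of the canonical integral representation of `f`, which exists and is unique
for every operator monotone decreasing `f` (and is set to `0` for an `f` without representation). -/
def reprMeasure (f : ℝ → ℝ) : Measure ℝ :=
  if h : ∃ μ : Measure ℝ, ∃ a b : ℝ, IsCanonicalRep f a b μ then h.choose else 0

/-- Regular operator monotone decreasing functions: `μ_f` is absolutely continuous with respect to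
Lebesgue measure and for all `S, T > 0` there is a finite `C` with `dt ≤ C dμ_f(t)` on `[1/S, T]`. -/
structure IsRegular (f : ℝ → ℝ) : Prop where
  operatorMonotoneDecreasing : IsOperatorMonotoneDecreasing f
  absolutelyContinuous : reprMeasure f ≪ volume
  exists_bound : ∀ S T : ℝ, 0 < S → 0 < T → ∃ C : ℝ≥0,
    (volume : Measure ℝ).restrict (Set.Icc (1 / S) T) ≤
      C • (reprMeasure f).restrict (Set.Icc (1 / S) T)

/-- `T_L(β)`. -/
def TL (β T : ℝ) : ℝ := if β ≤ 1 / 2 then T else T ^ ((1 - β) / β)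

/-- `T_R(β)`. -/
def TR (β T : ℝ) : ℝ := if β ≤ 1 / 2 then T ^ (β / (1 - β)) else T

/-- `C^f_{T,β}`: the least constant `C` with `dt ≤ C dμ_f(t)` on `[T_L(β)⁻¹, T_R(β)]`
(`∞` if there is none, `0` if the interval is empty). -/
def regConst (f : ℝ → ℝ) (T β : ℝ) : ℝ≥0∞ :=
  sInf {C : ℝ≥0∞ | (volume : Measure ℝ).restrict (Set.Icc (TL β T)⁻¹ (TR β T)) ≤
    C • (reprMeasure f).restrict (Set.Icc (TL β T)⁻¹ (TR β T))}

/-! ### States, powers, partial trace, norms -/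

section Matrices

variable {m n : Type*} [Fintype m] [Fintype n] [DecidableEq m] [DecidableEq n]

/-- Density matrices. -/
def IsState (ρ : Matrix n n ℂ) : Prop := ρ.PosSemidef ∧ ρ.trace = 1

/-- Real powers `A ^ s` of a positive semidefinite matrix, taken on the support of `A` (so that
`A ^ (-1)` is the generalized inverse and `A ^ 0` the support projection). -/
def gpow (A : Matrix n n ℂ) (s : ℝ) : Matrix n n ℂ :=
  cfc (fun x : ℝ => if x = 0 then 0 else x ^ s) A

/-- The partial trace over the second tensor factor. -/
def ptrace (X : Matrix (m × n) (m × n) ℂ) : Matrix m m ℂ :=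
  Matrix.of fun i j => ∑ k, X (i, k) (j, k)

/-- Hilbert-Schmidt norm. -/
def hsNorm (A : Matrix n n ℂ) : ℝ := Real.sqrt (Aᴴ * A).trace.re

/-- Operator norm. -/
def opNorm (A : Matrix n n ℂ) : ℝ := ‖Matrix.toEuclideanCLM (n := n) (𝕜 := ℂ) A‖

/-- The smallest non-zero eigenvalue of a (non-zero, positive semidefinite) matrix. -/
def minNonzeroEigenvalue (ρ : Matrix n n ℂ) : ℝ := sInf (spectrum ℝ ρ \ {0})

/-! ### The modular operator and the quasi-relative entropy -/

/-- The modular operator `Δ_{A,B}(X) = A X B⁻¹` (with the generalized inverse of `B`). -/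
def modular (A B : Matrix n n ℂ) : Matrix n n ℂ →ₗ[ℂ] Matrix n n ℂ :=
  LinearMap.mulLeft ℂ A ∘ₗ LinearMap.mulRight ℂ (gpow B (-1))

/-- `f(Φ)` for an operator `Φ` on the space of matrices that is self-adjoint for the
Hilbert-Schmidt inner product: functional calculus in the orthonormal basis of matrix units. -/
def funCalc (f : ℝ → ℝ) (Φ : Matrix n n ℂ →ₗ[ℂ] Matrix n n ℂ) :
    Matrix n n ℂ →ₗ[ℂ] Matrix n n ℂ :=
  LinearMap.toMatrix (stdBasis ℂ n n) (stdBasis ℂ n n) |>.symm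
    (cfc f (LinearMap.toMatrix (stdBasis ℂ n n) (stdBasis ℂ n n) Φ))

/-- The quasi-relative entropy `S_f^K(ρ‖σ) = Tr(√ρ K* f(Δ_{σ,ρ})(K √ρ))`. -/
def quasiEntropy (f : ℝ → ℝ) (K ρ σ : Matrix n n ℂ) : ℝ :=
  (gpow ρ (1 / 2) * Kᴴ * funCalc f (modular σ ρ) (K * gpow ρ (1 / 2))).trace.re

/-- `S_f^K(ρ‖σ)` is finite: `f` has a finite limit at `0` (which is then the value used at `0`), or
`ker σ ⊆ ker (ρ K*)` (and then the value of `f` at `0` is not used). The second alternative holds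
for every invertible `σ`. -/
def EntropyFinite (f : ℝ → ℝ) (K ρ σ : Matrix n n ℂ) : Prop :=
  Filter.Tendsto f (𝓝[>] 0) (𝓝 (f 0)) ∨
    ∀ v : n → ℂ, σ *ᵥ v = 0 → (ρ * Kᴴ) *ᵥ v = 0

/-- For `X` on `H₁`, the operator `X ⊗ 1` on `H₁ ⊗ H₂`. -/
def amp (n : Type*) [DecidableEq n] (X : Matrix m m ℂ) : Matrix (m × n) (m × n) ℂ :=
  X ⊗ₖ (1 : Matrix n n ℂ)

/-- `σ₁^β K ρ₁^{-β} ρ^{1/2} - σ^β K ρ^{1/2-β}`. -/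
def remainder (β : ℝ) (K ρ σ : Matrix (m × n) (m × n) ℂ) : Matrix (m × n) (m × n) ℂ :=
  amp n (gpow (ptrace σ) β) * K * amp n (gpow (ptrace ρ) (-β)) * gpow ρ (1 / 2) -
    gpow σ β * K * gpow ρ (1 / 2 - β)

end Matrices

/-- The exponent `α(β)`. -/
def expo (β c : ℝ) : ℝ :=
  if β ≤ 1 / 2 then β * (1 - β) / (1 + 2 * c * (1 - β)) else (1 / 2) * ((1 - β) / (1 + c))

/-- The constant `M`, as a function of an eigenvalue bound `r`, of `β`, of `κ = ‖K‖` and of `C`. -/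
def constM (r β κ C : ℝ) : ℝ :=
  Real.sin (Real.pi * β) / Real.pi * (2 * κ * (1 / β + 1 / (r * (1 - β))) + Real.sqrt C)

end QRE

end

/-!
The proof compares the resolvents of the two modular operators `Δ = Δ_{σ,ρ}` and `Δ₁ = Δ_{σ₁,ρ₁}`.
The map `U X = (X ⊗ V) ρ₁^{-1/2} ρ^{1/2}` is a contraction for the Hilbert-Schmidt norms, satisfies
`U* Δ U ≤ Δ₁`, and sends `ξ₁ = K₁ √ρ₁` to `ξ = K √ρ`, with `U* ξ = ξ₁` (`intertwined_transfer`).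
For `w t = U (t + Δ₁)⁻¹ ξ₁ - (t + Δ)⁻¹ ξ`, completing the square gives
`t ‖w t‖² ≤ ⟨ξ, (t + Δ)⁻¹ ξ⟩ - ⟨ξ₁, (t + Δ₁)⁻¹ ξ₁⟩` (`Intertwined.mul_norm_sq_le_gap`). The canonical
representation of `f` integrates the right-hand side to at most the entropy difference `D`, the
linear term of `f` having the right sign (`Intertwined.integral_gap_le`). So `0 ≤ D` and
`∫ t ‖w t‖² dμ_f ≤ D`.

On the other hand `x ^ β = (sin πβ / π) ∫ t ^ β (1/t - 1/(t + x)) dt`, hence the remainder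
`U Δ₁^β ξ₁ - Δ^β ξ` is `-(sin πβ / π) ∫ t ^ β w t dt` (`Intertwined.norm_rpow_sub_le`). This integral
is split at `1/T_L` and `T_R`. Near `0` one uses `‖w t‖ ≤ 2 ‖K‖ / t`, near `∞` the bound
`‖w t‖ ≤ 2 ‖K‖ / (r t²)`, and in between Lebesgue measure is dominated by `μ_f`
(`Intertwined.norm_rpow_sub_le_of_split`). Choosing `T` as a power of `D` balances the three parts
(`Intertwined.norm_rpow_sub_le_of_pos`).

The integral representation of `f` need not be constructed: regularity excludes the default value
`0` of `reprMeasure f` (`exists_isCanonicalRep`). If `f` has a limit at `0`, the representation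
extends to `x = 0` (`IsCanonicalRep.hasRepAt_zero`); otherwise the kernel condition, which passes to
the reduced states (`ker_condition_ptrace`), makes the value of `f` at `0` irrelevant.

All operators are written in eigenbases of `σ`, `ρ`, `σ₁`, `ρ₁`, where functions of `Δ` and `Δ₁` act
as multiplication operators (`coord_funCalc_modular`); this reduces the analytic part to two
diagonal operators on finite-dimensional Hilbert spaces.
-/

namespace QRE

open Set Filter

/-! ### The integral formula for fractional powers -/

lemma integral_Ioo_rpow_mul_one_sub_rpow {β : ℝ} (h0 : 0 < β) (h1 : β < 1) :
    ∫ s in Ioo (0 : ℝ) 1, s ^ (β - 1) * (1 - s) ^ (-β) = Real.pi / Real.sin (Real.pi * β) := by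
  have hB := ProbabilityTheory.beta_eq_betaIntegralReal β (1 - β) h0 (by linarith)
  have hG := Real.Gamma_mul_Gamma_one_sub β
  rw [← hG]
  have h2 : ProbabilityTheory.beta β (1 - β) = Real.Gamma β * Real.Gamma (1 - β) := by
    simp [ProbabilityTheory.beta]
  rw [← h2, hB, Complex.betaIntegral, intervalIntegral.integral_of_le zero_le_one,
    integral_Ioc_eq_integral_Ioo]
  have e : ∫ t in Ioo (0 : ℝ) 1, (t : ℂ) ^ ((β : ℂ) - 1) * (1 - (t : ℂ)) ^ (((1 - β : ℝ) : ℂ) - 1) =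
      ∫ t in Ioo (0 : ℝ) 1, ((t ^ (β - 1) * (1 - t) ^ (-β) : ℝ) : ℂ) := by
    refine setIntegral_congr_fun measurableSet_Ioo fun t ht => ?_
    rw [Complex.ofReal_mul, Complex.ofReal_cpow ht.1.le, Complex.ofReal_cpow (by linarith [ht.2])]
    push_cast
    congr 2
    ring
  rw [e, integral_complex_ofReal, Complex.ofReal_re]

lemma integral_rpowIntegrand_one {β : ℝ} (h0 : 0 < β) (h1 : β < 1) :
    ∫ t in Ioi (0 : ℝ), Real.rpowIntegrand₀₁ β t 1 = Real.pi / Real.sin (Real.pi * β) := by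
  have himg : (fun t : ℝ => t / (1 + t)) '' Ioi 0 = Ioo 0 1 := by
    ext s
    simp only [mem_image, mem_Ioi, mem_Ioo]
    constructor
    · rintro ⟨t, ht, rfl⟩
      exact ⟨by positivity, (div_lt_one (by positivity)).2 (by linarith)⟩
    · rintro ⟨hs0, hs1⟩
      have : 0 < 1 - s := by linarith
      refine ⟨s / (1 - s), by positivity, ?_⟩
      field_simp
      ring
  have hder : ∀ t ∈ Ioi (0 : ℝ),
      HasDerivWithinAt (fun t : ℝ => t / (1 + t)) (1 / (1 + t) ^ 2) (Ioi 0) t := by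
    intro t ht
    have ht' : (1 + t) ≠ 0 := by have : 0 < t := ht; positivity
    refine HasDerivAt.hasDerivWithinAt ?_
    refine ((hasDerivAt_id' t).div ((hasDerivAt_id' t).const_add 1) ht').congr_deriv ?_
    congr 1
    ring
  have hinj : InjOn (fun t : ℝ => t / (1 + t)) (Ioi 0) := by
    intro s hs t ht h
    have hs' : 0 < s := hs
    have ht' : 0 < t := ht
    have h := (div_eq_div_iff (by positivity) (by positivity)).1 h
    linarith
  have := integral_image_eq_integral_abs_deriv_smul measurableSet_Ioi hder hinj
    (fun s => s ^ (β - 1) * (1 - s) ^ (-β))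
  rw [himg, integral_Ioo_rpow_mul_one_sub_rpow h0 h1] at this
  rw [this]
  refine setIntegral_congr_fun measurableSet_Ioi fun t ht => ?_
  have ht' : 0 < t := ht
  have h1t : 0 < 1 + t := by positivity
  have e1 : 1 - t / (1 + t) = (1 + t)⁻¹ := by field_simp; ring
  simp only [smul_eq_mul]
  rw [Real.rpowIntegrand₀₁_eq_pow_div ⟨h0, h1⟩ ht'.le zero_le_one, e1,
    Real.div_rpow ht'.le h1t.le, Real.inv_rpow h1t.le, Real.rpow_neg h1t.le, inv_inv,
    Real.rpow_sub_one h1t.ne', abs_of_pos (by positivity), add_comm t 1]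
  have := (Real.rpow_pos_of_pos h1t β).ne'
  field_simp

lemma rpow_eq_sin_mul_integral {β x : ℝ} (h0 : 0 < β) (h1 : β < 1) (hx : 0 ≤ x) :
    x ^ β = Real.sin (Real.pi * β) / Real.pi *
      ∫ t in Ioi (0 : ℝ), Real.rpowIntegrand₀₁ β t x := by
  rw [Real.rpow_eq_const_mul_integral ⟨h0, h1⟩ hx, integral_rpowIntegrand_one h0 h1, inv_div]

/-! ### The canonical integral representation -/

lemma exists_isCanonicalRep {f : ℝ → ℝ} (hf : IsRegular f) :
    ∃ a b : ℝ, IsCanonicalRep f a b (reprMeasure f) := by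
  by_cases h : ∃ μ : Measure ℝ, ∃ a b : ℝ, IsCanonicalRep f a b μ
  · have : reprMeasure f = h.choose := by rw [reprMeasure, dif_pos h]
    rw [this]
    exact h.choose_spec
  · have h0 : reprMeasure f = 0 := by rw [reprMeasure, dif_neg h]
    obtain ⟨C, hC⟩ := hf.exists_bound 2 2 two_pos two_pos
    have := hC (Icc (1 / 2) 2)
    rw [h0] at this
    norm_num [Measure.restrict_apply_self] at this

/-- The value `f x` is given, with an integrable integrand, by the canonical representation. -/
def HasRepAt (f : ℝ → ℝ) (a b : ℝ) (μ : Measure ℝ) (x : ℝ) : Prop :=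
  Integrable (fun t : ℝ => 1 / (t + x) - t / (t ^ 2 + 1)) μ ∧
    f x = a * x + b + ∫ t, (1 / (t + x) - t / (t ^ 2 + 1)) ∂μ

lemma ae_pos {μ : Measure ℝ} (h : μ (Iio 0) = 0) (hac : μ ≪ volume) : ∀ᵐ t ∂μ, 0 < t := by
  have h0 : μ {0} = 0 := hac (by simp)
  rw [ae_iff]
  refine measure_mono_null (t := Iio 0 ∪ {0}) (fun t ht => ?_) (measure_union_null h h0)
  rcases (not_lt.1 ht).lt_or_eq with h | h
  · exact Or.inl h
  · exact Or.inr h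

lemma IsCanonicalRep.hasRepAt {f : ℝ → ℝ} {a b : ℝ} {μ : Measure ℝ} (h : IsCanonicalRep f a b μ)
    (hμ : ∀ᵐ t ∂μ, 0 < t) {x : ℝ} (hx : 0 < x) : HasRepAt f a b μ x := by
  refine ⟨?_, h.eq x hx⟩
  refine (h.integrable.const_mul (1 / x + x)).mono' ?_ ?_
  · exact Measurable.aestronglyMeasurable (by fun_prop)
  · filter_upwards [hμ] with t ht
    have e : 1 / (t + x) - t / (t ^ 2 + 1) = (1 - t * x) / (t + x) * (1 / (t ^ 2 + 1)) := by
      field_simp; ring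
    rw [e, Real.norm_eq_abs, abs_mul, abs_of_pos (a := 1 / (t ^ 2 + 1)) (by positivity)]
    gcongr
    rw [abs_div, abs_of_pos (a := t + x) (by positivity), div_le_iff₀ (by positivity)]
    have : |1 - t * x| ≤ 1 + t * x :=
      abs_le.2 ⟨by nlinarith [mul_pos ht hx], by nlinarith [mul_pos ht hx]⟩
    refine this.trans ?_
    have e2 : (1 / x + x) * (t + x) = 1 + t * x + (t / x + x ^ 2) := by field_simp; ring
    rw [e2]
    have : 0 ≤ t / x + x ^ 2 := by positivity
    linarith

lemma IsCanonicalRep.hasRepAt_zero {f : ℝ → ℝ} {a b : ℝ} {μ : Measure ℝ}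
    (h : IsCanonicalRep f a b μ) (hμ : ∀ᵐ t ∂μ, 0 < t)
    (hlim : Tendsto f (𝓝[>] 0) (𝓝 (f 0))) : HasRepAt f a b μ 0 := by
  set u : ℕ → ℝ := fun n => 1 / ((n : ℝ) + 1) with hu
  have hu0 : ∀ n, 0 < u n := fun n => by positivity
  have hu1 : ∀ n, u n ≤ 1 := fun n => by
    rw [hu]; simp only; rw [div_le_one (by positivity)]; linarith [Nat.cast_nonneg (α := ℝ) n]
  have hut : Tendsto u atTop (𝓝 0) := tendsto_one_div_add_atTop_nhds_zero_nat
  have hut' : Tendsto u atTop (𝓝[>] 0) :=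
    tendsto_nhdsWithin_iff.2 ⟨hut, Eventually.of_forall hu0⟩
  have hk : ∀ n, Integrable (fun t : ℝ => 1 / (t + u n) - t / (t ^ 2 + 1)) μ :=
    fun n => (h.hasRepAt hμ (hu0 n)).1
  have hk1 : Integrable (fun t : ℝ => 1 / (t + 1) - t / (t ^ 2 + 1)) μ :=
    (h.hasRepAt hμ one_pos).1
  have hint : ∀ n, ∫ t, (1 / (t + u n) - 1 / (t + 1)) ∂μ = f (u n) - a * u n - (f 1 - a) := by
    intro n
    have : ∀ t : ℝ, 1 / (t + u n) - 1 / (t + 1) =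
      (1 / (t + u n) - t / (t ^ 2 + 1)) - (1 / (t + 1) - t / (t ^ 2 + 1)) := fun t => by ring
    simp_rw [this]
    rw [integral_sub (hk n) hk1, h.eq _ (hu0 n), h.eq 1 one_pos]
    ring
  have hfu : Tendsto (fun n => f (u n) - a * u n - (f 1 - a)) atTop
      (𝓝 (f 0 - a * 0 - (f 1 - a))) :=
    ((hlim.comp hut').sub (hut.const_mul a)).sub_const _
  -- Fatou's lemma makes the pointwise increasing limit integrable
  have hfin : ∫⁻ t, ENNReal.ofReal (1 / t - 1 / (t + 1)) ∂μ < ∞ := by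
    have hle : ∫⁻ t, ENNReal.ofReal (1 / t - 1 / (t + 1)) ∂μ ≤
        liminf (fun n => ∫⁻ t, ENNReal.ofReal (1 / (t + u n) - 1 / (t + 1)) ∂μ) atTop := by
      refine le_trans (lintegral_mono_ae ?_)
        (lintegral_liminf_le (fun n => Measurable.ennreal_ofReal (by fun_prop)))
      filter_upwards [hμ] with t ht
      have : Tendsto (fun n => ENNReal.ofReal (1 / (t + u n) - 1 / (t + 1))) atTop
          (𝓝 (ENNReal.ofReal (1 / t - 1 / (t + 1)))) := by
        refine (ENNReal.continuous_ofReal.tendsto _).comp (Tendsto.sub_const ?_ _)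
        have := (hut.const_add t)
        rw [add_zero] at this
        exact tendsto_const_nhds.div this ht.ne'
      exact this.liminf_eq.ge
    refine hle.trans_lt ?_
    have : ∀ n, ∫⁻ t, ENNReal.ofReal (1 / (t + u n) - 1 / (t + 1)) ∂μ =
        ENNReal.ofReal (f (u n) - a * u n - (f 1 - a)) := by
      intro n
      rw [← hint n, ofReal_integral_eq_lintegral_ofReal]
      · have := (hk n).sub hk1
        refine this.congr (Eventually.of_forall fun t => ?_)
        simp
      · filter_upwards [hμ] with t ht
        have : 1 / (t + 1) ≤ 1 / (t + u n) :=
          one_div_le_one_div_of_le (by linarith [hu0 n]) (by linarith [hu1 n])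
        simpa using this
    simp_rw [this]
    have := ((ENNReal.continuous_ofReal.tendsto _).comp hfu).liminf_eq
    simp only [Function.comp_def] at this
    rw [this]
    exact ENNReal.ofReal_lt_top
  have hI : Integrable (fun t : ℝ => 1 / t - 1 / (t + 1)) μ := by
    refine ⟨Measurable.aestronglyMeasurable (by fun_prop), ?_⟩
    rw [hasFiniteIntegral_iff_ofReal]
    · exact hfin
    · filter_upwards [hμ] with t ht
      have : 1 / (t + 1) ≤ 1 / t := one_div_le_one_div_of_le ht (by linarith)
      simpa using this
  have hI0 : Integrable (fun t : ℝ => 1 / (t + 0) - t / (t ^ 2 + 1)) μ := by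
    refine (hI.add hk1).congr (Eventually.of_forall fun t => ?_)
    simp
  have hlim2 : Tendsto (fun n => ∫ t, (1 / (t + u n) - 1 / (t + 1)) ∂μ) atTop
      (𝓝 (∫ t, (1 / t - 1 / (t + 1)) ∂μ)) := by
    refine tendsto_integral_of_dominated_convergence (fun t => 1 / t - 1 / (t + 1))
      (fun n => Measurable.aestronglyMeasurable (by fun_prop)) hI (fun n => ?_) ?_
    · filter_upwards [hμ] with t ht
      have h1 : 1 / (t + 1) ≤ 1 / (t + u n) :=
        one_div_le_one_div_of_le (by linarith [hu0 n]) (by linarith [hu1 n])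
      have h2 : 1 / (t + u n) ≤ 1 / t := one_div_le_one_div_of_le ht (by linarith [hu0 n])
      rw [Real.norm_of_nonneg (by linarith)]
      linarith
    · filter_upwards [hμ] with t ht
      refine Tendsto.sub_const ?_ _
      have := (hut.const_add t)
      rw [add_zero] at this
      exact tendsto_const_nhds.div this ht.ne'
  refine ⟨hI0, ?_⟩
  simp_rw [hint] at hlim2
  have heq := tendsto_nhds_unique hlim2 hfu
  have e : ∫ t, (1 / (t + 0) - t / (t ^ 2 + 1)) ∂μ = (∫ t, (1 / t - 1 / (t + 1)) ∂μ) +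
      ∫ t, (1 / (t + 1) - t / (t ^ 2 + 1)) ∂μ := by
    rw [← integral_add hI hk1]
    refine integral_congr_ae (Eventually.of_forall fun t => ?_)
    simp
  rw [e, heq]
  have := h.eq 1 one_pos
  linarith

/-! ### Two diagonal operators intertwined by a contraction -/

lemma re_star_mul_self (z : ℂ) : (star z * z).re = ‖z‖ ^ 2 := by
  rw [Complex.sq_norm, Complex.normSq_apply]
  simp [Complex.mul_re]

lemma mul_norm_sub_sq {s : ℝ} (hs : s ≠ 0) (u z : ℂ) :
    s * ‖u - ((s⁻¹ : ℝ) : ℂ) * z‖ ^ 2 = s * ‖u‖ ^ 2 - 2 * (star u * z).re + s⁻¹ * ‖z‖ ^ 2 := by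
  simp only [Complex.sq_norm, Complex.normSq_apply, Complex.sub_re, Complex.sub_im, Complex.mul_re,
    Complex.mul_im, Complex.ofReal_re, Complex.ofReal_im, Complex.star_def, Complex.conj_re,
    Complex.conj_im]
  field_simp
  ring

section Intertwined

variable {ι ι₁ : Type*} [Fintype ι] [Fintype ι₁]

/-- The diagonal operator with entries `g`, applied to `v`. -/
noncomputable def diagMul (g : ι → ℝ) (v : EuclideanSpace ℂ ι) : EuclideanSpace ℂ ι :=
  WithLp.toLp 2 fun i => (g i : ℂ) * v i

omit [Fintype ι] in
@[simp]
lemma diagMul_apply (g : ι → ℝ) (v : EuclideanSpace ℂ ι) (i : ι) :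
    diagMul g v i = (g i : ℂ) * v i := rfl

lemma norm_diagMul_le {g : ι → ℝ} {k : ℝ} (hk : 0 ≤ k) (hg : ∀ i, |g i| ≤ k)
    (v : EuclideanSpace ℂ ι) : ‖diagMul g v‖ ≤ k * ‖v‖ := by
  refine le_of_sq_le_sq ?_ (by positivity)
  rw [mul_pow, EuclideanSpace.norm_sq_eq, EuclideanSpace.norm_sq_eq, Finset.mul_sum]
  refine Finset.sum_le_sum fun i _ => ?_
  rw [diagMul_apply, norm_mul, mul_pow, Complex.norm_real]
  gcongr
  exact hg i

lemma diagMul_eq_sum [DecidableEq ι] (g : ι → ℝ) (v : EuclideanSpace ℂ ι) :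
    diagMul g v = ∑ i, g i • EuclideanSpace.single i (v i) := by
  ext j
  simp [Finset.sum_apply, Pi.single_apply]

lemma integrable_diagMul {g : ℝ → ι → ℝ} {μ : Measure ℝ} (hg : ∀ i, Integrable (fun t => g t i) μ)
    (v : EuclideanSpace ℂ ι) : Integrable (fun t => diagMul (g t) v) μ := by
  classical
  simp_rw [diagMul_eq_sum]
  exact integrable_finsetSum _ fun i _ => (hg i).smul_const _

lemma integral_diagMul {g : ℝ → ι → ℝ} {μ : Measure ℝ} (hg : ∀ i, Integrable (fun t => g t i) μ)
    (v : EuclideanSpace ℂ ι) :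
    ∫ t, diagMul (g t) v ∂μ = diagMul (fun i => ∫ t, g t i ∂μ) v := by
  classical
  simp_rw [diagMul_eq_sum]
  rw [integral_finsetSum _ fun i _ => (hg i).smul_const _]
  simp_rw [integral_smul_const]

/-- The diagonal operators with entries `x` and `x₁` model the two modular operators, `U` the
contraction between the two spaces of operators, and `ξ`, `ξ₁` the vectors `K √ρ`, `K₁ √ρ₁`.
The fields `form_le` and `adjoint` say `U* x U ≤ x₁` and, in its real part, `U* ξ = ξ₁`. -/
structure Intertwined (x : ι → ℝ) (x₁ : ι₁ → ℝ)
    (U : EuclideanSpace ℂ ι₁ →ₗ[ℂ] EuclideanSpace ℂ ι)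
    (ξ : EuclideanSpace ℂ ι) (ξ₁ : EuclideanSpace ℂ ι₁) : Prop where
  nonneg : ∀ i, 0 ≤ x i
  nonneg₁ : ∀ i, 0 ≤ x₁ i
  contr : ∀ v, ∑ i, ‖U v i‖ ^ 2 ≤ ∑ i, ‖v i‖ ^ 2
  form_le : ∀ v, ∑ i, x i * ‖U v i‖ ^ 2 ≤ ∑ i, x₁ i * ‖v i‖ ^ 2
  adjoint : ∀ v, ∑ i, (star (U v i) * ξ i).re = ∑ i, (star (v i) * ξ₁ i).re
  map_eq : U ξ₁ = ξ

/-- The failure `U (t + x₁)⁻¹ ξ₁ - (t + x)⁻¹ ξ` of `U` to intertwine the resolvents. -/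
noncomputable def resolventDefect (x : ι → ℝ) (x₁ : ι₁ → ℝ)
    (U : EuclideanSpace ℂ ι₁ →ₗ[ℂ] EuclideanSpace ℂ ι)
    (ξ : EuclideanSpace ℂ ι) (ξ₁ : EuclideanSpace ℂ ι₁) (t : ℝ) : EuclideanSpace ℂ ι :=
  U (diagMul (fun i => (t + x₁ i)⁻¹) ξ₁) - diagMul (fun i => (t + x i)⁻¹) ξ

/-- The difference `⟨ξ, (t + x)⁻¹ ξ⟩ - ⟨ξ₁, (t + x₁)⁻¹ ξ₁⟩` of resolvent expectations. -/
noncomputable def resolventGap (x : ι → ℝ) (x₁ : ι₁ → ℝ)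
    (ξ : EuclideanSpace ℂ ι) (ξ₁ : EuclideanSpace ℂ ι₁) (t : ℝ) : ℝ :=
  ∑ i, (t + x i)⁻¹ * ‖ξ i‖ ^ 2 - ∑ i, (t + x₁ i)⁻¹ * ‖ξ₁ i‖ ^ 2

namespace Intertwined

variable {x : ι → ℝ} {x₁ : ι₁ → ℝ} {U : EuclideanSpace ℂ ι₁ →ₗ[ℂ] EuclideanSpace ℂ ι}
  {ξ : EuclideanSpace ℂ ι} {ξ₁ : EuclideanSpace ℂ ι₁}

lemma norm_map_le (h : Intertwined x x₁ U ξ ξ₁) (v : EuclideanSpace ℂ ι₁) : ‖U v‖ ≤ ‖v‖ := by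
  refine le_of_sq_le_sq ?_ (by positivity)
  rw [EuclideanSpace.norm_sq_eq, EuclideanSpace.norm_sq_eq]
  exact h.contr v

lemma sum_sq_eq (h : Intertwined x x₁ U ξ ξ₁) : ∑ i, ‖ξ i‖ ^ 2 = ∑ i, ‖ξ₁ i‖ ^ 2 := by
  have := h.adjoint ξ₁
  simpa only [h.map_eq, re_star_mul_self] using this

lemma norm_eq (h : Intertwined x x₁ U ξ ξ₁) : ‖ξ‖ = ‖ξ₁‖ := by
  rw [EuclideanSpace.norm_eq, EuclideanSpace.norm_eq, h.sum_sq_eq]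

/-- Completing the square: `⟨w, (t + x) w⟩` is at most the gap of the resolvent expectations. -/
lemma mul_norm_sq_le_gap (h : Intertwined x x₁ U ξ ξ₁) {t : ℝ} (ht : 0 < t) :
    t * ‖resolventDefect x x₁ U ξ ξ₁ t‖ ^ 2 ≤ resolventGap x x₁ ξ ξ₁ t := by
  set η := diagMul (fun i => (t + x₁ i)⁻¹) ξ₁ with hη
  have hx : ∀ i, t + x i ≠ 0 := fun i => by have := h.nonneg i; positivity
  have hx₁ : ∀ i, t + x₁ i ≠ 0 := fun i => by have := h.nonneg₁ i; positivity
  have e1 : t * ‖resolventDefect x x₁ U ξ ξ₁ t‖ ^ 2 ≤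
      ∑ i, (t + x i) * ‖U η i - (((t + x i)⁻¹ : ℝ) : ℂ) * ξ i‖ ^ 2 := by
    rw [EuclideanSpace.norm_sq_eq, Finset.mul_sum]
    refine Finset.sum_le_sum fun i _ => ?_
    have := h.nonneg i
    have e : resolventDefect x x₁ U ξ ξ₁ t i = U η i - (((t + x i)⁻¹ : ℝ) : ℂ) * ξ i := by
      simp [resolventDefect, hη]
    rw [e]
    gcongr
    linarith
  simp_rw [mul_norm_sub_sq (hx _), Finset.sum_add_distrib, Finset.sum_sub_distrib, add_mul,
    Finset.sum_add_distrib, ← Finset.mul_sum, h.adjoint η] at e1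
  have e2 : ∑ i, (star (η i) * ξ₁ i).re = ∑ i, (t + x₁ i)⁻¹ * ‖ξ₁ i‖ ^ 2 := by
    refine Finset.sum_congr rfl fun i _ => ?_
    rw [hη, diagMul_apply, ← re_star_mul_self, star_mul', Complex.star_def, Complex.conj_ofReal,
      mul_assoc, Complex.re_ofReal_mul]
  have e3 : t * ∑ i, ‖η i‖ ^ 2 + ∑ i, x₁ i * ‖η i‖ ^ 2 = ∑ i, (t + x₁ i)⁻¹ * ‖ξ₁ i‖ ^ 2 := by
    rw [Finset.mul_sum, ← Finset.sum_add_distrib]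
    refine Finset.sum_congr rfl fun i _ => ?_
    rw [hη, diagMul_apply, norm_mul, Complex.norm_real, mul_pow, Real.norm_eq_abs, sq_abs]
    have := hx₁ i
    field_simp
  have e4 := h.contr η
  have e5 := h.form_le η
  have e6 := mul_le_mul_of_nonneg_left e4 ht.le
  rw [resolventGap]
  linarith

lemma gap_nonneg (h : Intertwined x x₁ U ξ ξ₁) {t : ℝ} (ht : 0 < t) :
    0 ≤ resolventGap x x₁ ξ ξ₁ t :=
  le_trans (by positivity) (h.mul_norm_sq_le_gap ht)

lemma norm_defect_le (h : Intertwined x x₁ U ξ ξ₁) {t : ℝ} (ht : 0 < t) :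
    ‖resolventDefect x x₁ U ξ ξ₁ t‖ ≤ 2 * ‖ξ‖ / t := by
  have b1 : ‖diagMul (fun i => (t + x₁ i)⁻¹) ξ₁‖ ≤ t⁻¹ * ‖ξ₁‖ := by
    refine norm_diagMul_le (by positivity) (fun i => ?_) _
    have := h.nonneg₁ i
    rw [abs_of_pos (by positivity)]
    gcongr
    linarith
  have b2 : ‖diagMul (fun i => (t + x i)⁻¹) ξ‖ ≤ t⁻¹ * ‖ξ‖ := by
    refine norm_diagMul_le (by positivity) (fun i => ?_) _
    have := h.nonneg i
    rw [abs_of_pos (by positivity)]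
    gcongr
    linarith
  refine (norm_sub_le _ _).trans ?_
  refine (add_le_add ((h.norm_map_le _).trans b1) b2).trans (le_of_eq ?_)
  rw [h.norm_eq]
  ring

lemma norm_defect_le_sq (h : Intertwined x x₁ U ξ ξ₁) {t : ℝ} (ht : 0 < t) :
    ‖resolventDefect x x₁ U ξ ξ₁ t‖ ≤ (‖diagMul x ξ‖ + ‖diagMul x₁ ξ₁‖) / t ^ 2 := by
  -- both resolvents are compared with `1 / t`, since `U ξ₁ = ξ`
  have e : resolventDefect x x₁ U ξ ξ₁ t =
      diagMul (fun i => t⁻¹ * (t + x i)⁻¹) (diagMul x ξ) -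
        U (diagMul (fun i => t⁻¹ * (t + x₁ i)⁻¹) (diagMul x₁ ξ₁)) := by
    have e1 : diagMul (fun i => (t + x₁ i)⁻¹) ξ₁ =
        (t⁻¹ : ℂ) • ξ₁ - diagMul (fun i => t⁻¹ * (t + x₁ i)⁻¹) (diagMul x₁ ξ₁) := by
      ext i
      have : (t : ℂ) + x₁ i ≠ 0 := by
        have := h.nonneg₁ i
        exact_mod_cast (by positivity : t + x₁ i ≠ 0)
      have : (t : ℂ) ≠ 0 := by exact_mod_cast ht.ne'
      simp
      field_simp
      ring
    have e2 : diagMul (fun i => (t + x i)⁻¹) ξ =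
        (t⁻¹ : ℂ) • ξ - diagMul (fun i => t⁻¹ * (t + x i)⁻¹) (diagMul x ξ) := by
      ext i
      have : (t : ℂ) + x i ≠ 0 := by
        have := h.nonneg i
        exact_mod_cast (by positivity : t + x i ≠ 0)
      have : (t : ℂ) ≠ 0 := by exact_mod_cast ht.ne'
      simp
      field_simp
      ring
    rw [resolventDefect, e1, e2, map_sub, map_smul, h.map_eq]
    abel
  have b1 : ‖diagMul (fun i => t⁻¹ * (t + x₁ i)⁻¹) (diagMul x₁ ξ₁)‖ ≤
      t⁻¹ * t⁻¹ * ‖diagMul x₁ ξ₁‖ := by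
    refine norm_diagMul_le (by positivity) (fun i => ?_) _
    have := h.nonneg₁ i
    rw [abs_of_pos (by positivity)]
    gcongr
    linarith
  have b2 : ‖diagMul (fun i => t⁻¹ * (t + x i)⁻¹) (diagMul x ξ)‖ ≤
      t⁻¹ * t⁻¹ * ‖diagMul x ξ‖ := by
    refine norm_diagMul_le (by positivity) (fun i => ?_) _
    have := h.nonneg i
    rw [abs_of_pos (by positivity)]
    gcongr
    linarith
  rw [e]
  refine (norm_sub_le _ _).trans ?_
  refine (add_le_add b2 ((h.norm_map_le _).trans b1)).trans (le_of_eq ?_)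
  field_simp

/-! ### The entropy difference controls the resolvent defects -/

lemma integral_sum_of_hasRepAt {f : ℝ → ℝ} {a b : ℝ} {μ : Measure ℝ} {x : ι → ℝ}
    {ξ : EuclideanSpace ℂ ι} (hrep : ∀ i, ξ i ≠ 0 → HasRepAt f a b μ (x i)) :
    Integrable (fun t : ℝ => ∑ i, (1 / (t + x i) - t / (t ^ 2 + 1)) * ‖ξ i‖ ^ 2) μ ∧
      ∑ i, f (x i) * ‖ξ i‖ ^ 2 = a * ∑ i, x i * ‖ξ i‖ ^ 2 + b * ∑ i, ‖ξ i‖ ^ 2 +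
        ∫ t : ℝ, ∑ i, (1 / (t + x i) - t / (t ^ 2 + 1)) * ‖ξ i‖ ^ 2 ∂μ := by
  have hi : ∀ i, Integrable (fun t : ℝ => (1 / (t + x i) - t / (t ^ 2 + 1)) * ‖ξ i‖ ^ 2) μ := by
    intro i
    by_cases h0 : ξ i = 0
    · simp [h0]
    · exact (hrep i h0).1.mul_const _
  refine ⟨integrable_finsetSum _ fun i _ => hi i, ?_⟩
  rw [integral_finsetSum _ fun i _ => hi i, Finset.mul_sum, Finset.mul_sum,
    ← Finset.sum_add_distrib, ← Finset.sum_add_distrib]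
  refine Finset.sum_congr rfl fun i _ => ?_
  by_cases h0 : ξ i = 0
  · simp [h0]
  · rw [integral_mul_const, (hrep i h0).2]
    ring

lemma integral_gap_le (h : Intertwined x x₁ U ξ ξ₁) {f : ℝ → ℝ} {a b : ℝ} {μ : Measure ℝ}
    (ha : a ≤ 0) (hrep : ∀ i, ξ i ≠ 0 → HasRepAt f a b μ (x i))
    (hrep₁ : ∀ i, ξ₁ i ≠ 0 → HasRepAt f a b μ (x₁ i)) :
    Integrable (resolventGap x x₁ ξ ξ₁) μ ∧
      ∫ t, resolventGap x x₁ ξ ξ₁ t ∂μ ≤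
        ∑ i, f (x i) * ‖ξ i‖ ^ 2 - ∑ i, f (x₁ i) * ‖ξ₁ i‖ ^ 2 := by
  obtain ⟨hi, he⟩ := integral_sum_of_hasRepAt hrep
  obtain ⟨hi₁, he₁⟩ := integral_sum_of_hasRepAt hrep₁
  have e : resolventGap x x₁ ξ ξ₁ = fun t : ℝ =>
      ∑ i, (1 / (t + x i) - t / (t ^ 2 + 1)) * ‖ξ i‖ ^ 2 -
        ∑ i, (1 / (t + x₁ i) - t / (t ^ 2 + 1)) * ‖ξ₁ i‖ ^ 2 := by
    funext t
    simp_rw [resolventGap, sub_mul, Finset.sum_sub_distrib, ← Finset.mul_sum, h.sum_sq_eq,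
      one_div]
    ring
  refine ⟨e ▸ hi.sub hi₁, ?_⟩
  rw [e, integral_sub hi hi₁, he, he₁, h.sum_sq_eq]
  have := h.form_le ξ₁
  rw [h.map_eq] at this
  have := mul_le_mul_of_nonpos_left this ha
  linarith

end Intertwined

end Intertwined

/-! ### Estimate of the difference of fractional powers -/

section PowerEstimate

lemma lintegral_Ioc_const_mul_rpow_sub_one {β A k : ℝ} (h0 : 0 < β) (hA : 0 < A) (hk : 0 ≤ k) :
    ∫⁻ t in Ioc 0 A, ENNReal.ofReal (k * t ^ (β - 1)) = ENNReal.ofReal (k * (A ^ β / β)) := by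
  have hint : IntervalIntegrable (fun t : ℝ => t ^ (β - 1)) volume 0 A :=
    intervalIntegral.intervalIntegrable_rpow' (by linarith)
  have hint' := ((intervalIntegrable_iff_integrableOn_Ioc_of_le hA.le).1 hint).const_mul k
  rw [← ofReal_integral_eq_lintegral_ofReal hint', integral_const_mul,
    ← intervalIntegral.integral_of_le hA.le, integral_rpow (Or.inl (by linarith))]
  · simp [h0.ne']
  · refine ae_restrict_of_forall_mem measurableSet_Ioc fun t ht => ?_
    have : 0 < t := ht.1
    simp only [Pi.zero_apply]
    positivity

lemma lintegral_Ioi_const_mul_rpow_sub_two {β B k : ℝ} (h1 : β < 1) (hB : 0 < B) (hk : 0 ≤ k) :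
    ∫⁻ t in Ioi B, ENNReal.ofReal (k * t ^ (β - 2)) =
      ENNReal.ofReal (k * (B ^ (β - 1) / (1 - β))) := by
  have hint := (integrableOn_Ioi_rpow_of_lt (a := β - 2) (by linarith) hB).const_mul k
  rw [← ofReal_integral_eq_lintegral_ofReal hint, integral_const_mul,
    integral_Ioi_rpow_of_lt (by linarith) hB]
  · congr 2
    rw [show β - 2 + 1 = -(1 - β) by ring, div_neg, neg_div, neg_neg, neg_sub]
  · refine ae_restrict_of_forall_mem measurableSet_Ioi fun t ht => ?_
    have : 0 < t := hB.trans ht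
    simp only [Pi.zero_apply]
    positivity

lemma lintegral_le_sInf_mul {μ : Measure ℝ} {I : Set ℝ} {F : ℝ → ℝ≥0∞} {d : ℝ≥0∞}
    (hF : ∫⁻ t, F t ∂μ ≤ d) (hd0 : d ≠ 0) (hd : d ≠ ∞) :
    ∫⁻ t in I, F t ≤
      sInf {c : ℝ≥0∞ | (volume : Measure ℝ).restrict I ≤ c • μ.restrict I} * d := by
  rw [← ENNReal.div_le_iff hd0 hd]
  refine le_sInf fun c hc => ?_
  rw [ENNReal.div_le_iff hd0 hd]
  calc ∫⁻ t in I, F t ≤ ∫⁻ t, F t ∂(c • μ.restrict I) := lintegral_mono' hc le_rfl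
    _ = c * ∫⁻ t in I, F t ∂μ := by rw [lintegral_smul_measure, smul_eq_mul]
    _ ≤ c * d := by gcongr; exact (lintegral_mono' Measure.restrict_le_self le_rfl).trans hF

variable {ι ι₁ : Type*} [Fintype ι] [Fintype ι₁] {x : ι → ℝ} {x₁ : ι₁ → ℝ}
  {U : EuclideanSpace ℂ ι₁ →ₗ[ℂ] EuclideanSpace ℂ ι}
  {ξ : EuclideanSpace ℂ ι} {ξ₁ : EuclideanSpace ℂ ι₁}

lemma Intertwined.norm_rpow_sub_le (h : Intertwined x x₁ U ξ ξ₁) {β : ℝ} (h0 : 0 < β)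
    (h1 : β < 1) :
    ENNReal.ofReal ‖U (diagMul (fun i => x₁ i ^ β) ξ₁) - diagMul (fun i => x i ^ β) ξ‖ ≤
      ENNReal.ofReal (Real.sin (Real.pi * β) / Real.pi) *
        ∫⁻ t in Ioi 0, ENNReal.ofReal (t ^ β * ‖resolventDefect x x₁ U ξ ξ₁ t‖) := by
  set s := Real.sin (Real.pi * β) / Real.pi with hs
  have hs0 : 0 ≤ s := div_nonneg (Real.sin_nonneg_of_nonneg_of_le_pi
    (by have := Real.pi_pos; positivity) (by nlinarith [Real.pi_pos])) Real.pi_pos.le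
  have hi : ∀ i, Integrable (fun t => Real.rpowIntegrand₀₁ β t (x i)) (volume.restrict (Ioi 0)) :=
    fun i => Real.integrableOn_rpowIntegrand₀₁_Ioi ⟨h0, h1⟩ (h.nonneg i)
  have hi₁ : ∀ i, Integrable (fun t => Real.rpowIntegrand₀₁ β t (x₁ i))
      (volume.restrict (Ioi 0)) :=
    fun i => Real.integrableOn_rpowIntegrand₀₁_Ioi ⟨h0, h1⟩ (h.nonneg₁ i)
  have e : U (diagMul (fun i => x₁ i ^ β) ξ₁) - diagMul (fun i => x i ^ β) ξ =
      s • ∫ t in Ioi 0, (U (diagMul (fun i => Real.rpowIntegrand₀₁ β t (x₁ i)) ξ₁) -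
        diagMul (fun i => Real.rpowIntegrand₀₁ β t (x i)) ξ) := by
    have hU := (LinearMap.toContinuousLinearMap U).integral_comp_comm (integrable_diagMul hi₁ ξ₁)
    have hUi := (LinearMap.toContinuousLinearMap U).integrable_comp (integrable_diagMul hi₁ ξ₁)
    simp only [LinearMap.coe_toContinuousLinearMap'] at hU hUi
    rw [integral_sub hUi (integrable_diagMul hi ξ), hU, integral_diagMul hi, integral_diagMul hi₁,
      smul_sub]
    congr 1
    · rw [← LinearMap.map_smul_of_tower]
      congr 1
      ext i
      simp [rpow_eq_sin_mul_integral h0 h1 (h.nonneg₁ i), hs, mul_assoc]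
    · ext i
      simp [rpow_eq_sin_mul_integral h0 h1 (h.nonneg i), hs, mul_assoc]
  rw [e, norm_smul, Real.norm_of_nonneg hs0, ENNReal.ofReal_mul hs0, ofReal_norm]
  gcongr
  refine (enorm_integral_le_lintegral_enorm _).trans (le_of_eq ?_)
  refine setLIntegral_congr_fun measurableSet_Ioi fun t ht => ?_
  have ht0 : 0 < t := ht
  have e1 : U (diagMul (fun i => Real.rpowIntegrand₀₁ β t (x₁ i)) ξ₁) -
        diagMul (fun i => Real.rpowIntegrand₀₁ β t (x i)) ξ =
      -((t ^ β : ℝ) : ℂ) • resolventDefect x x₁ U ξ ξ₁ t := by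
    have a1 : diagMul (fun i => Real.rpowIntegrand₀₁ β t (x₁ i)) ξ₁ =
        ((t ^ β : ℝ) : ℂ) • ((t⁻¹ : ℂ) • ξ₁ - diagMul (fun i => (t + x₁ i)⁻¹) ξ₁) := by
      ext i; simp [Real.rpowIntegrand₀₁]; ring
    have a2 : diagMul (fun i => Real.rpowIntegrand₀₁ β t (x i)) ξ =
        ((t ^ β : ℝ) : ℂ) • ((t⁻¹ : ℂ) • ξ - diagMul (fun i => (t + x i)⁻¹) ξ) := by
      ext i; simp [Real.rpowIntegrand₀₁]; ring
    rw [a1, a2, map_smul, map_sub, map_smul, h.map_eq, resolventDefect, neg_smul, ← smul_sub,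
      ← smul_neg]
    congr 1
    abel
  rw [e1, ← ofReal_norm, norm_smul, norm_neg, Complex.norm_real, Real.norm_of_nonneg (by positivity)]

/-- The integral of `t ^ β ‖w_t‖` is split at `A` and `B`; the middle part is estimated through
`∫ t ‖w_t‖² dt ≤ E`. -/
lemma Intertwined.norm_rpow_sub_le_of_split (h : Intertwined x x₁ U ξ ξ₁) {β : ℝ} (h0 : 0 < β)
    (h1 : β < 1) {A B N E G k L : ℝ} (hA : 0 < A) (hB : 0 < B) (hN : 0 < N)
    (hE : 0 < E) (hk : ‖ξ‖ ≤ k) (hL : ‖diagMul x ξ‖ ≤ L) (hL₁ : ‖diagMul x₁ ξ₁‖ ≤ L)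
    (hAG : A ^ β ≤ G) (hBG : B ^ (β - 1) ≤ G)
    (hNt : ∀ t ∈ Icc A B, t ^ (2 * β - 1) ≤ N)
    (hmid : ∫⁻ t in Icc A B, ENNReal.ofReal (t * ‖resolventDefect x x₁ U ξ ξ₁ t‖ ^ 2) ≤
      ENNReal.ofReal E) :
    ‖U (diagMul (fun i => x₁ i ^ β) ξ₁) - diagMul (fun i => x i ^ β) ξ‖ ≤
      Real.sin (Real.pi * β) / Real.pi *
        (2 * k * G / β + 2 * L * G / (1 - β) + Real.sqrt (N * B * E)) := by
  set w := resolventDefect x x₁ U ξ ξ₁ with hw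
  have hk0 : 0 ≤ k := (norm_nonneg _).trans hk
  have hL0 : 0 ≤ L := (norm_nonneg _).trans hL
  have hG0 : 0 < G := (Real.rpow_pos_of_pos hA β).trans_le hAG
  have hβ' : 0 < 1 - β := by linarith
  have p1 : ∫⁻ t in Ioc 0 A, ENNReal.ofReal (t ^ β * ‖w t‖) ≤
      ENNReal.ofReal (2 * k * G / β) := by
    calc ∫⁻ t in Ioc 0 A, ENNReal.ofReal (t ^ β * ‖w t‖)
        ≤ ∫⁻ t in Ioc 0 A, ENNReal.ofReal (2 * k * t ^ (β - 1)) := by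
          refine setLIntegral_mono' measurableSet_Ioc fun t ht => ENNReal.ofReal_le_ofReal ?_
          have ht0 : 0 < t := ht.1
          calc t ^ β * ‖w t‖ ≤ t ^ β * (2 * k / t) := by
                gcongr
                exact (h.norm_defect_le ht0).trans (by gcongr)
            _ = 2 * k * t ^ (β - 1) := by
                rw [Real.rpow_sub_one ht0.ne']; ring
      _ = ENNReal.ofReal (2 * k * (A ^ β / β)) :=
          lintegral_Ioc_const_mul_rpow_sub_one h0 hA (by positivity)
      _ ≤ _ := by
          refine ENNReal.ofReal_le_ofReal ?_
          rw [mul_div_assoc]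
          gcongr
  have p3 : ∫⁻ t in Ioi B, ENNReal.ofReal (t ^ β * ‖w t‖) ≤
      ENNReal.ofReal (2 * L * G / (1 - β)) := by
    calc ∫⁻ t in Ioi B, ENNReal.ofReal (t ^ β * ‖w t‖)
        ≤ ∫⁻ t in Ioi B, ENNReal.ofReal (2 * L * t ^ (β - 2)) := by
          refine setLIntegral_mono' measurableSet_Ioi fun t ht => ENNReal.ofReal_le_ofReal ?_
          have ht0 : 0 < t := hB.trans ht
          calc t ^ β * ‖w t‖ ≤ t ^ β * ((L + L) / t ^ 2) := by
                gcongr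
                exact (h.norm_defect_le_sq ht0).trans (by gcongr)
            _ = 2 * L * t ^ (β - 2) := by
                rw [Real.rpow_sub ht0, Real.rpow_two]; ring
      _ = ENNReal.ofReal (2 * L * (B ^ (β - 1) / (1 - β))) :=
          lintegral_Ioi_const_mul_rpow_sub_two h1 hB (by positivity)
      _ ≤ _ := by
          refine ENNReal.ofReal_le_ofReal ?_
          rw [mul_div_assoc]
          gcongr
  have p2 : ∫⁻ t in Icc A B, ENNReal.ofReal (t ^ β * ‖w t‖) ≤
      ENNReal.ofReal (Real.sqrt (N * B * E)) := by
    -- the weight `s` balances the two terms of the arithmetic-geometric mean inequality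
    set s := Real.sqrt (N * B * E) / (N * B) with hs
    have hq : 0 < Real.sqrt (N * B * E) := Real.sqrt_pos.2 (by positivity)
    have hs0 : 0 < s := by positivity
    calc ∫⁻ t in Icc A B, ENNReal.ofReal (t ^ β * ‖w t‖)
        ≤ ∫⁻ t in Icc A B, (ENNReal.ofReal (s / 2 * N) +
            ENNReal.ofReal (1 / (2 * s)) * ENNReal.ofReal (t * ‖w t‖ ^ 2)) := by
          refine setLIntegral_mono' measurableSet_Icc fun t ht => ?_
          have ht0 : 0 < t := hA.trans_le ht.1
          rw [← ENNReal.ofReal_mul (by positivity), ← ENNReal.ofReal_add (by positivity)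
            (by positivity)]
          refine ENNReal.ofReal_le_ofReal ?_
          have e1 : (t ^ β) ^ 2 = t ^ (2 * β - 1) * t := by
            rw [Real.rpow_sub_one ht0.ne', mul_comm 2 β, Real.rpow_mul ht0.le, Real.rpow_two]
            field_simp
          have e2 : (t ^ β) ^ 2 ≤ N * t := e1 ▸ by gcongr; exact hNt t ht
          have e3 : t ^ β * ‖w t‖ ≤ s / 2 * ((t ^ β) ^ 2 / t) + 1 / (2 * s) * (t * ‖w t‖ ^ 2) := by
            have : s / 2 * ((t ^ β) ^ 2 / t) + 1 / (2 * s) * (t * ‖w t‖ ^ 2) - t ^ β * ‖w t‖ =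
                (s * t ^ β - t * ‖w t‖) ^ 2 / (2 * s * t) := by
              field_simp
              ring
            have h2 : 0 ≤ (s * t ^ β - t * ‖w t‖) ^ 2 / (2 * s * t) := by positivity
            linarith
          refine e3.trans ?_
          gcongr
          rw [div_le_iff₀ ht0]
          exact e2
      _ = ENNReal.ofReal (s / 2 * N) * volume (Icc A B) + ENNReal.ofReal (1 / (2 * s)) *
            ∫⁻ t in Icc A B, ENNReal.ofReal (t * ‖w t‖ ^ 2) := by
          rw [lintegral_add_left measurable_const, setLIntegral_const,
            lintegral_const_mul' _ _ ENNReal.ofReal_ne_top]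
      _ ≤ ENNReal.ofReal (s / 2 * N) * ENNReal.ofReal B +
            ENNReal.ofReal (1 / (2 * s)) * ENNReal.ofReal E := by
          gcongr
          rw [Real.volume_Icc]
          exact ENNReal.ofReal_le_ofReal (by linarith)
      _ = ENNReal.ofReal (Real.sqrt (N * B * E)) := by
          rw [← ENNReal.ofReal_mul (by positivity), ← ENNReal.ofReal_mul (by positivity),
            ← ENNReal.ofReal_add (by positivity) (by positivity)]
          congr 1
          have : Real.sqrt (N * B * E) ^ 2 = N * B * E := Real.sq_sqrt (by positivity)
          rw [hs]
          field_simp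
          nlinarith
  have hsub : Ioi (0 : ℝ) ⊆ (Ioc 0 A ∪ Icc A B) ∪ Ioi B := by
    intro t ht
    have : 0 < t := ht
    rcases le_or_gt t A with hA' | hA'
    · exact Or.inl (Or.inl ⟨this, hA'⟩)
    · rcases le_or_gt t B with hB' | hB'
      · exact Or.inl (Or.inr ⟨hA'.le, hB'⟩)
      · exact Or.inr hB'
  have hs0 : 0 ≤ Real.sin (Real.pi * β) / Real.pi := div_nonneg
    (Real.sin_nonneg_of_nonneg_of_le_pi (by have := Real.pi_pos; positivity)
      (by nlinarith [Real.pi_pos])) Real.pi_pos.le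
  have hX : 0 ≤ 2 * k * G / β := by positivity
  have hY : 0 ≤ 2 * L * G / (1 - β) := by positivity
  have hZ : 0 ≤ Real.sqrt (N * B * E) := Real.sqrt_nonneg _
  rw [← ENNReal.ofReal_le_ofReal_iff (by positivity)]
  refine (h.norm_rpow_sub_le h0 h1).trans ?_
  rw [ENNReal.ofReal_mul hs0]
  gcongr
  refine (lintegral_mono_set hsub).trans ((lintegral_union_le _ _ _).trans ?_)
  refine (add_le_add_left (lintegral_union_le _ _ _) _).trans ?_
  refine (add_le_add (add_le_add p1 p2) p3).trans (le_of_eq ?_)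
  rw [← ENNReal.ofReal_add hX hZ, ← ENNReal.ofReal_add (by positivity) hY]
  congr 1
  ring

lemma Intertwined.lintegral_defect_le (h : Intertwined x x₁ U ξ ξ₁) {μ : Measure ℝ}
    (hμ : ∀ᵐ t ∂μ, 0 < t) (hi : Integrable (resolventGap x x₁ ξ ξ₁) μ) {D : ℝ}
    (hD : ∫ t, resolventGap x x₁ ξ ξ₁ t ∂μ ≤ D) :
    ∫⁻ t, ENNReal.ofReal (t * ‖resolventDefect x x₁ U ξ ξ₁ t‖ ^ 2) ∂μ ≤ ENNReal.ofReal D := by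
  refine le_trans (lintegral_mono_ae (g := fun t => ENNReal.ofReal (resolventGap x x₁ ξ ξ₁ t)) ?_) ?_
  · filter_upwards [hμ] with t ht
    exact ENNReal.ofReal_le_ofReal (h.mul_norm_sq_le_gap ht)
  · rw [← ofReal_integral_eq_lintegral_ofReal hi]
    · exact ENNReal.ofReal_le_ofReal hD
    · filter_upwards [hμ] with t ht
      exact h.gap_nonneg ht

/-- The estimate for a positive upper bound `D` of the integrated gap. Positivity allows the cutoff
parameter `T` to be a negative power of `D`. -/
lemma Intertwined.norm_rpow_sub_le_of_pos (h : Intertwined x x₁ U ξ ξ₁) {f : ℝ → ℝ}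
    {β c C : ℝ} (h0 : 0 < β) (h1 : β < 1) (hc : 0 < c) (hC : 0 < C)
    (hreg : ∀ T : ℝ, 0 < T → regConst f T β ≤ ENNReal.ofReal (C * T ^ (2 * c)))
    (hμ : ∀ᵐ t ∂(reprMeasure f), 0 < t)
    (hi : Integrable (resolventGap x x₁ ξ ξ₁) (reprMeasure f)) {D r k : ℝ} (hD0 : 0 < D)
    (hD : ∫ t, resolventGap x x₁ ξ ξ₁ t ∂(reprMeasure f) ≤ D)
    (hk : ‖ξ‖ ≤ k) (hL : ‖diagMul x ξ‖ ≤ k / r) (hL₁ : ‖diagMul x₁ ξ₁‖ ≤ k / r) :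
    ‖U (diagMul (fun i => x₁ i ^ β) ξ₁) - diagMul (fun i => x i ^ β) ξ‖ ≤
      constM r β k C * D ^ expo β c := by
  have hβ' : 0 < 1 - β := by linarith
  -- the exponent `q` is chosen such that `D = T ^ (-q)` balances the three parts
  obtain ⟨q, hq⟩ : ∃ q, q = if β ≤ 1 / 2 then 2 * c + 1 / (1 - β) else 2 * c + 2 := ⟨_, rfl⟩
  have hq0 : 0 < q := by rw [hq]; split_ifs <;> positivity
  set T := D ^ (-1 / q) with hT
  have hT0 : 0 < T := Real.rpow_pos_of_pos hD0 _
  have hDT : D = T ^ (-q) := by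
    rw [hT, ← Real.rpow_mul hD0.le]
    have : -1 / q * -q = 1 := by field_simp
    rw [this, Real.rpow_one]
  have main : ∀ {A B N G : ℝ}, A = (TL β T)⁻¹ → B = TR β T → 0 < A → 0 < B → 0 < N → 0 < G →
      A ^ β = G → B ^ (β - 1) = G → (∀ t ∈ Icc A B, t ^ (2 * β - 1) ≤ N) →
      N * B * (T ^ (2 * c) * D) = G ^ 2 → D ^ expo β c = G →
      ‖U (diagMul (fun i => x₁ i ^ β) ξ₁) - diagMul (fun i => x i ^ β) ξ‖ ≤
        constM r β k C * D ^ expo β c := by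
    intro A B N G eA eB hA hB hN hG hAG hBG hNt hNG hDG
    have hmid : ∫⁻ t in Icc A B,
        ENNReal.ofReal (t * ‖resolventDefect x x₁ U ξ ξ₁ t‖ ^ 2) ≤
          ENNReal.ofReal (C * T ^ (2 * c) * D) := by
      refine (lintegral_le_sInf_mul (h.lintegral_defect_le hμ hi hD)
        (ENNReal.ofReal_pos.2 hD0).ne' ENNReal.ofReal_ne_top).trans ?_
      rw [ENNReal.ofReal_mul (by positivity)]
      gcongr
      have := hreg T hT0
      rwa [regConst, ← eA, ← eB] at this
    refine (h.norm_rpow_sub_le_of_split h0 h1 hA hB hN (by positivity) hk hL hL₁ hAG.le hBG.le hNt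
      hmid).trans (le_of_eq ?_)
    rw [show N * B * (C * T ^ (2 * c) * D) = C * G ^ 2 by rw [← hNG]; ring,
      Real.sqrt_mul hC.le, Real.sqrt_sq hG.le, hDG, constM, one_div, one_div, mul_inv]
    ring
  rcases le_or_gt β (1 / 2) with hβ | hβ
  · have hqe : q = 2 * c + 1 / (1 - β) := by rw [hq, if_pos hβ]
    refine main (A := T⁻¹) (B := T ^ (β / (1 - β))) (N := T⁻¹ ^ (2 * β - 1)) (G := T ^ (-β))
      (by rw [TL, if_pos hβ]) (by rw [TR, if_pos hβ]) (by positivity) (by positivity)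
      (by positivity) (by positivity) ?_ ?_ ?_ ?_ ?_
    · rw [Real.inv_rpow hT0.le, Real.rpow_neg hT0.le]
    · rw [← Real.rpow_mul hT0.le]
      congr 1
      field_simp
      ring
    · intro t ht
      exact Real.rpow_le_rpow_of_nonpos (by positivity) ht.1 (by linarith)
    · rw [hDT, ← Real.rpow_neg_one T, ← Real.rpow_mul hT0.le, ← Real.rpow_add hT0,
        ← Real.rpow_add hT0, ← Real.rpow_add hT0, ← Real.rpow_two, ← Real.rpow_mul hT0.le, hqe]
      congr 1
      field_simp
      ring
    · rw [hDT, ← Real.rpow_mul hT0.le, expo, if_pos hβ, hqe]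
      congr 1
      field_simp
      ring
  · have hqe : q = 2 * c + 2 := by rw [hq, if_neg (not_le.2 hβ)]
    refine main (A := (T ^ ((1 - β) / β))⁻¹) (B := T) (N := T ^ (2 * β - 1)) (G := T ^ (β - 1))
      (by rw [TL, if_neg (not_le.2 hβ)]) (by rw [TR, if_neg (not_le.2 hβ)]) (by positivity) hT0
      (by positivity) (by positivity) ?_ rfl ?_ ?_ ?_
    · rw [← Real.rpow_neg hT0.le, ← Real.rpow_mul hT0.le]
      congr 1
      field_simp
      ring
    · intro t ht
      refine Real.rpow_le_rpow (le_trans (by positivity) ht.1) ht.2 (by linarith)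
    · rw [hDT, ← Real.rpow_add_one hT0.ne', 
        ← Real.rpow_add hT0, ← Real.rpow_add hT0, ← Real.rpow_two, ← Real.rpow_mul hT0.le, hqe]
      congr 1
      ring
    · rw [hDT, ← Real.rpow_mul hT0.le, expo, if_neg (not_le.2 hβ), hqe]
      congr 1
      field_simp
      ring

lemma expo_pos {β c : ℝ} (h0 : 0 < β) (h1 : β < 1) (hc : 0 < c) : 0 < expo β c := by
  have : 0 < 1 - β := by linarith
  rw [expo]
  split_ifs <;> positivity

/-- The entropy difference is nonnegative and controls the difference of fractional powers. Zero
eigenvalues are harmless if `f` is continuous at `0` from the right, or if `ξ` and `ξ₁` have no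
component there. -/
theorem Intertwined.norm_rpow_sub_le_entropy (h : Intertwined x x₁ U ξ ξ₁) {f : ℝ → ℝ}
    (hf : IsRegular f)
    {β c C : ℝ} (h0 : 0 < β) (h1 : β < 1) (hc : 0 < c) (hC : 0 < C)
    (hreg : ∀ T : ℝ, 0 < T → regConst f T β ≤ ENNReal.ofReal (C * T ^ (2 * c)))
    (hfin : Tendsto f (𝓝[>] 0) (𝓝 (f 0)) ∨
      (∀ i, x i = 0 → ξ i = 0) ∧ (∀ i, x₁ i = 0 → ξ₁ i = 0)) {D : ℝ}
    (hD : D = ∑ i, f (x i) * ‖ξ i‖ ^ 2 - ∑ i, f (x₁ i) * ‖ξ₁ i‖ ^ 2) :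
    0 ≤ D ∧ ∀ r k : ℝ, ‖ξ‖ ≤ k → ‖diagMul x ξ‖ ≤ k / r → ‖diagMul x₁ ξ₁‖ ≤ k / r →
      ‖U (diagMul (fun i => x₁ i ^ β) ξ₁) - diagMul (fun i => x i ^ β) ξ‖ ≤
        constM r β k C * D ^ expo β c := by
  obtain ⟨a, b, hrep⟩ := exists_isCanonicalRep hf
  have hμ := ae_pos hrep.support hf.absolutelyContinuous
  have hpos : ∀ (y : ℝ) (z : ℂ), 0 ≤ y → (Tendsto f (𝓝[>] 0) (𝓝 (f 0)) ∨ (y = 0 → z = 0)) →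
      z ≠ 0 → HasRepAt f a b (reprMeasure f) y := by
    intro y z hy hv hi
    rcases hy.eq_or_lt with h0 | h0
    · rcases hv with hv | hv
      · rw [← h0]; exact hrep.hasRepAt_zero hμ hv
      · exact absurd (hv h0.symm) hi
    · exact hrep.hasRepAt hμ h0
  obtain ⟨hi, hle⟩ := h.integral_gap_le hrep.nonpos
    (fun i => hpos (x i) (ξ i) (h.nonneg i) (hfin.imp_right fun h => h.1 i))
    (fun i => hpos (x₁ i) (ξ₁ i) (h.nonneg₁ i) (hfin.imp_right fun h => h.2 i))
  rw [← hD] at hle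
  have hD0 : 0 ≤ D := by
    refine le_trans (integral_nonneg_of_ae ?_) hle
    filter_upwards [hμ] with t ht
    exact h.gap_nonneg ht
  refine ⟨hD0, fun r k hk hL hL₁ => ?_⟩
  -- `D = 0` is reached as a limit of positive upper bounds
  have hcont : Tendsto (fun d : ℝ => constM r β k C * d ^ expo β c) (𝓝[>] D)
      (𝓝 (constM r β k C * D ^ expo β c)) := by
    refine Tendsto.mono_left ?_ nhdsWithin_le_nhds
    exact ((Real.continuousAt_rpow_const _ _ (Or.inr (expo_pos h0 h1 hc).le)).const_mul _)
  refine ge_of_tendsto hcont ?_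
  filter_upwards [self_mem_nhdsWithin] with d hd
  have hd' : D < d := hd
  exact h.norm_rpow_sub_le_of_pos h0 h1 hc hC hreg hμ hi (hD0.trans_lt hd')
    (hle.trans hd'.le) hk hL hL₁

end PowerEstimate

/-! ### Diagonalization and functional calculus -/

section Diagonalization

variable {m n : Type*} [Fintype m] [Fintype n] [DecidableEq m] [DecidableEq n]

/-- The unitary matrix `Q` diagonalizes `A`, with eigenvalues `x`. -/
structure Diagonalizes (Q : Matrix n n ℂ) (x : n → ℝ) (A : Matrix n n ℂ) : Prop where
  conjTranspose_mul_self : Qᴴ * Q = 1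
  mul_conjTranspose_self : Q * Qᴴ = 1
  eq : A = Q * diagonal (fun i => (x i : ℂ)) * Qᴴ

namespace Diagonalizes

variable {Q : Matrix n n ℂ} {x : n → ℝ} {A : Matrix n n ℂ}

lemma mul_eq (h : Diagonalizes Q x A) : Qᴴ * A = diagonal (fun i => (x i : ℂ)) * Qᴴ := by
  rw [h.eq, ← Matrix.mul_assoc, ← Matrix.mul_assoc, h.conjTranspose_mul_self, Matrix.one_mul]

lemma eq_mul (h : Diagonalizes Q x A) : A * Q = Q * diagonal (fun i => (x i : ℂ)) := by
  rw [h.eq, Matrix.mul_assoc, h.conjTranspose_mul_self, Matrix.mul_one]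

lemma isHermitian (h : Diagonalizes Q x A) : A.IsHermitian := by
  rw [Matrix.IsHermitian, h.eq, conjTranspose_mul, conjTranspose_mul, conjTranspose_conjTranspose,
    diagonal_conjTranspose, ← Matrix.mul_assoc]
  congr 3
  ext i
  simp

lemma mul {y : n → ℝ} {B : Matrix n n ℂ} (h : Diagonalizes Q x A) (h' : Diagonalizes Q y B) :
    Diagonalizes Q (fun i => x i * y i) (A * B) := by
  refine ⟨h.1, h.2, ?_⟩
  rw [h.eq, Matrix.mul_assoc, Matrix.mul_assoc, h'.mul_eq, ← Matrix.mul_assoc (diagonal _),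
    diagonal_mul_diagonal, ← Matrix.mul_assoc]
  simp

lemma one (h : Diagonalizes Q x A) : Diagonalizes Q (fun _ => 1) (1 : Matrix n n ℂ) := by
  refine ⟨h.1, h.2, ?_⟩
  simp [h.2]

lemma add {y : n → ℝ} {B : Matrix n n ℂ} (h : Diagonalizes Q x A) (h' : Diagonalizes Q y B) :
    Diagonalizes Q (fun i => x i + y i) (A + B) := by
  refine ⟨h.1, h.2, ?_⟩
  rw [h.eq, h'.eq, ← Matrix.add_mul, ← Matrix.mul_add, diagonal_add]
  simp

lemma smul (h : Diagonalizes Q x A) (r : ℝ) : Diagonalizes Q (fun i => r * x i) (r • A) := by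
  refine ⟨h.1, h.2, ?_⟩
  rw [h.eq, ← Matrix.smul_mul, ← Matrix.mul_smul, ← diagonal_smul]
  congr 3
  ext i
  simp

lemma pow (h : Diagonalizes Q x A) (k : ℕ) : Diagonalizes Q (fun i => x i ^ k) (A ^ k) := by
  induction k with
  | zero => simpa using h.one
  | succ k ih => simpa only [pow_succ] using ih.mul h

lemma aeval (h : Diagonalizes Q x A) (p : Polynomial ℝ) :
    Diagonalizes Q (fun i => p.eval (x i)) (Polynomial.aeval A p) := by
  induction p using Polynomial.induction_on' with
  | add p q hp hq => simpa using hp.add hq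
  | monomial k r =>
    simpa [Polynomial.aeval_monomial, Algebra.algebraMap_eq_smul_one] using (h.pow k).smul r

/-- The functional calculus acts on the eigenvalues. -/
lemma cfc (h : Diagonalizes Q x A) (f : ℝ → ℝ) :
    Diagonalizes Q (fun i => f (x i)) (cfc f A) := by
  have hfin : (spectrum ℝ A).Finite := Matrix.finite_real_spectrum
  -- `f` agrees with a polynomial on the finite set of eigenvalues
  set s : Finset ℝ := hfin.toFinset ∪ Finset.univ.image x
  set p := Lagrange.interpolate s id f
  have hp : ∀ y ∈ s, p.eval y = f y := fun y hy =>
    Lagrange.eval_interpolate_at_node (v := id) f Function.injective_id.injOn hy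
  have e1 : _root_.cfc f A = Polynomial.aeval A p := by
    rw [← cfc_polynomial p A h.isHermitian.isSelfAdjoint]
    exact cfc_congr fun y hy => (hp y (by simp [s, hy])).symm
  have e2 : (fun i => f (x i)) = fun i => p.eval (x i) := by
    funext i
    exact (hp _ (by simp [s])).symm
  rw [e1, e2]
  exact h.aeval p

lemma kronecker {R : Matrix m m ℂ} {y : m → ℝ} {B : Matrix m m ℂ} (h : Diagonalizes Q x A)
    (h' : Diagonalizes R y B) :
    Diagonalizes (Q ⊗ₖ R) (fun p => x p.1 * y p.2) (A ⊗ₖ B) := by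
  refine ⟨?_, ?_, ?_⟩
  · rw [conjTranspose_kronecker, ← mul_kronecker_mul, h.1, h'.1, one_kronecker_one]
  · rw [conjTranspose_kronecker, ← mul_kronecker_mul, h.2, h'.2, one_kronecker_one]
  · rw [h.eq, h'.eq, conjTranspose_kronecker, mul_kronecker_mul, mul_kronecker_mul,
      diagonal_kronecker_diagonal]
    simp

lemma transpose (h : Diagonalizes Q x A) : Diagonalizes Qᴴᵀ x Aᵀ := by
  refine ⟨?_, ?_, ?_⟩
  · rw [← transpose_one, ← h.1, transpose_mul]
    congr 1
    ext i j; simp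
  · rw [← transpose_one, ← h.2, transpose_mul]
    congr 1
    ext i j; simp
  · rw [h.eq, transpose_mul, transpose_mul, diagonal_transpose, ← Matrix.mul_assoc]
    congr 1
    ext i j; simp

lemma trace_eq (h : Diagonalizes Q x A) : A.trace = ((∑ i, x i : ℝ) : ℂ) := by
  rw [h.eq, trace_mul_comm, ← Matrix.mul_assoc, h.1, Matrix.one_mul, trace_diagonal]
  simp

end Diagonalizes

lemma diagonalizes_of_isHermitian {A : Matrix n n ℂ} (hA : A.IsHermitian) :
    Diagonalizes (hA.eigenvectorUnitary : Matrix n n ℂ) hA.eigenvalues A := by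
  refine ⟨?_, ?_, ?_⟩
  · exact Unitary.coe_star_mul_self _
  · exact Unitary.coe_mul_star_self _
  · conv_lhs => rw [hA.spectral_theorem]
    rw [Unitary.conjStarAlgAut_apply]
    rfl

/-- The scalar function behind `gpow`: the power `x ^ s`, set to `0` at `x = 0`. -/
noncomputable def suppPow (s x : ℝ) : ℝ := if x = 0 then 0 else x ^ s

@[simp] lemma suppPow_zero (s : ℝ) : suppPow s 0 = 0 := if_pos rfl

lemma suppPow_of_ne {x : ℝ} (hx : x ≠ 0) (s : ℝ) : suppPow s x = x ^ s := if_neg hx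

lemma suppPow_nonneg {x : ℝ} (hx : 0 ≤ x) (s : ℝ) : 0 ≤ suppPow s x := by
  unfold suppPow; split_ifs <;> positivity

lemma suppPow_mul {x : ℝ} (hx : 0 ≤ x) (s t : ℝ) :
    suppPow s x * suppPow t x = suppPow (s + t) x := by
  rcases hx.eq_or_lt with h | h
  · simp [← h]
  · rw [suppPow_of_ne h.ne', suppPow_of_ne h.ne', suppPow_of_ne h.ne', Real.rpow_add h]

lemma suppPow_one (x : ℝ) : suppPow 1 x = x := by
  unfold suppPow; split_ifs with h <;> simp [h]

lemma suppPow_eq_rpow {s : ℝ} (hs : 0 < s) (x : ℝ) : suppPow s x = x ^ s := by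
  unfold suppPow; split_ifs with h
  · rw [h, Real.zero_rpow hs.ne']
  · rfl

/-- A spectral decomposition of a density matrix. -/
structure StateDiag (Q : Matrix n n ℂ) (x : n → ℝ) (ρ : Matrix n n ℂ) : Prop
    extends Diagonalizes Q x ρ where
  nonneg : ∀ i, 0 ≤ x i
  sum_eq_one : ∑ i, x i = 1
  spectrum_eq : spectrum ℝ ρ = range x

lemma IsState.exists_stateDiag {ρ : Matrix n n ℂ} (h : IsState ρ) :
    ∃ (Q : Matrix n n ℂ) (x : n → ℝ), StateDiag Q x ρ := by
  have hd := diagonalizes_of_isHermitian h.1.isHermitian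
  refine ⟨_, _, hd, fun i => h.1.eigenvalues_nonneg i, ?_,
    h.1.isHermitian.spectrum_real_eq_range_eigenvalues⟩
  exact_mod_cast hd.trace_eq.symm.trans h.2

namespace StateDiag

variable {Q : Matrix n n ℂ} {x : n → ℝ} {ρ : Matrix n n ℂ}

lemma gpow (h : StateDiag Q x ρ) (s : ℝ) :
    Diagonalizes Q (fun i => suppPow s (x i)) (gpow ρ s) := by
  unfold QRE.gpow
  exact h.toDiagonalizes.cfc _

lemma gpow_conjTranspose (h : StateDiag Q x ρ) (s : ℝ) : (QRE.gpow ρ s)ᴴ = QRE.gpow ρ s :=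
  (h.gpow s).isHermitian

lemma gpow_mul (h : StateDiag Q x ρ) (s t : ℝ) :
    QRE.gpow ρ s * QRE.gpow ρ t = QRE.gpow ρ (s + t) := by
  rw [((h.gpow s).mul (h.gpow t)).eq, (h.gpow (s + t)).eq]
  simp_rw [suppPow_mul (h.nonneg _)]

lemma gpow_one (h : StateDiag Q x ρ) : QRE.gpow ρ 1 = ρ := by
  rw [(h.gpow 1).eq]
  simp_rw [suppPow_one]
  exact h.eq.symm

lemma le_one (h : StateDiag Q x ρ) (i : n) : x i ≤ 1 :=
  h.sum_eq_one ▸ Finset.single_le_sum (fun j _ => h.nonneg j) (Finset.mem_univ i)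

lemma minNonzeroEigenvalue_le (h : StateDiag Q x ρ) {i : n} (hi : x i ≠ 0) :
    minNonzeroEigenvalue ρ ≤ x i := by
  unfold minNonzeroEigenvalue
  rw [h.spectrum_eq]
  exact csInf_le ((finite_range x).sdiff.bddBelow) ⟨mem_range_self i, hi⟩

lemma minNonzeroEigenvalue_pos (h : StateDiag Q x ρ) : 0 < minNonzeroEigenvalue ρ := by
  have hne : ∃ i, x i ≠ 0 := by
    by_contra! hc
    have := h.sum_eq_one
    simp [hc] at this
  obtain ⟨i, hi⟩ := hne
  have hmem : minNonzeroEigenvalue ρ ∈ range x \ {0} := by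
    unfold minNonzeroEigenvalue
    rw [h.spectrum_eq]
    exact (Set.Nonempty.csInf_mem ⟨x i, mem_range_self i, hi⟩ ((finite_range x).sdiff))
  obtain ⟨⟨j, hj⟩, h0⟩ := hmem
  rw [← hj]
  refine lt_of_le_of_ne (h.nonneg j) fun h' => h0 ?_
  rw [← hj, ← h']
  rfl

end StateDiag

/-! ### Coordinates with respect to two eigenbases -/

/-- The coordinates of `X` in the orthonormal basis of matrix units `q_i w_j*` built from the
columns of `Q` and `W`. -/
noncomputable def coord (Q W X : Matrix n n ℂ) : EuclideanSpace ℂ (n × n) :=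
  WithLp.toLp 2 fun p => (Qᴴ * X * W) p.1 p.2

omit [DecidableEq n] in
lemma coord_apply (Q W X : Matrix n n ℂ) (p : n × n) : coord Q W X p = (Qᴴ * X * W) p.1 p.2 := rfl

variable {Q W : Matrix n n ℂ} {x y : n → ℝ} {A B : Matrix n n ℂ}

lemma coord_mul_left (h : Diagonalizes Q x A) (X : Matrix n n ℂ) (p : n × n) :
    coord Q W (A * X) p = x p.1 * coord Q W X p := by
  rw [coord_apply, coord_apply, ← Matrix.mul_assoc, h.mul_eq, Matrix.mul_assoc, Matrix.mul_assoc,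
    diagonal_mul, Matrix.mul_assoc]

lemma coord_mul_right (h : Diagonalizes W y B) (X : Matrix n n ℂ) (p : n × n) :
    coord Q W (X * B) p = coord Q W X p * y p.2 := by
  rw [coord_apply, coord_apply, ← Matrix.mul_assoc, Matrix.mul_assoc, h.eq_mul, ← Matrix.mul_assoc,
    mul_diagonal]

lemma trace_conjTranspose_mul_eq_sum (hQ : Q * Qᴴ = 1) (hW : W * Wᴴ = 1) (X Y : Matrix n n ℂ) :
    (Xᴴ * Y).trace = ∑ p, star (coord Q W X p) * coord Q W Y p := by
  have e : (Xᴴ * Y).trace = ((Qᴴ * X * W)ᴴ * (Qᴴ * Y * W)).trace := by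
    rw [conjTranspose_mul, conjTranspose_mul, conjTranspose_conjTranspose]
    have : Wᴴ * (Xᴴ * Q) * (Qᴴ * Y * W) = Wᴴ * (Xᴴ * (Q * Qᴴ) * Y) * W := by
      simp only [Matrix.mul_assoc]
    rw [this, hQ, Matrix.mul_one, trace_mul_comm _ W, ← Matrix.mul_assoc, hW, Matrix.one_mul]
  rw [e, trace]
  simp_rw [diag_apply, Matrix.mul_apply (M := (Qᴴ * X * W)ᴴ), conjTranspose_apply]
  rw [Finset.sum_comm, Fintype.sum_prod_type]
  rfl

lemma trace_mul_re_eq_sum (hQ : Q * Qᴴ = 1) (hW : W * Wᴴ = 1) (X Y : Matrix n n ℂ) :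
    (Xᴴ * Y).trace.re = ∑ p, (star (coord Q W X p) * coord Q W Y p).re := by
  rw [trace_conjTranspose_mul_eq_sum hQ hW, Complex.re_sum]

lemma trace_self_re_eq_sum (hQ : Q * Qᴴ = 1) (hW : W * Wᴴ = 1) (X : Matrix n n ℂ) :
    (Xᴴ * X).trace.re = ∑ p, ‖coord Q W X p‖ ^ 2 := by
  simp_rw [trace_mul_re_eq_sum hQ hW, re_star_mul_self]

lemma hsNorm_eq_norm_coord (hQ : Q * Qᴴ = 1) (hW : W * Wᴴ = 1) (X : Matrix n n ℂ) :
    hsNorm X = ‖coord Q W X‖ := by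
  rw [hsNorm, trace_self_re_eq_sum hQ hW, EuclideanSpace.norm_eq]

omit [DecidableEq n] in
lemma stdBasis_repr_apply (X : Matrix n n ℂ) (p : n × n) :
    (Matrix.stdBasis ℂ n n).repr X p = X p.1 p.2 := by
  simp [Matrix.stdBasis]

lemma toMatrix_mulLeft_comp_mulRight (A B : Matrix n n ℂ) :
    LinearMap.toMatrix (stdBasis ℂ n n) (stdBasis ℂ n n)
      (LinearMap.mulLeft ℂ A ∘ₗ LinearMap.mulRight ℂ B) = A ⊗ₖ Bᵀ := by
  ext ⟨i, j⟩ ⟨k, l⟩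
  rw [LinearMap.toMatrix_apply, stdBasis_repr_apply, stdBasis_eq_single]
  simp [Matrix.mul_apply, Matrix.single_apply, ite_and, kroneckerMap_apply]

omit [DecidableEq n] in
lemma kronecker_transpose_mulVec (A B X : Matrix n n ℂ) (p : n × n) :
    ((A ⊗ₖ Bᵀ) *ᵥ fun q => X q.1 q.2) p = (A * X * B) p.1 p.2 := by
  simp only [mulVec, dotProduct, Fintype.sum_prod_type, kroneckerMap_apply, Matrix.mul_apply,
    transpose_apply, Finset.sum_mul]
  rw [Finset.sum_comm]
  refine Finset.sum_congr rfl fun k _ => Finset.sum_congr rfl fun l _ => by ring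

/-- In the coordinates of the eigenbases, a function of the modular operator is multiplication by
the values at the quotients of eigenvalues. -/
lemma coord_funCalc_modular {σ ρ : Matrix n n ℂ} (hσ : StateDiag Q x σ) (hρ : StateDiag W y ρ)
    (f : ℝ → ℝ) (X : Matrix n n ℂ) (p : n × n) :
    coord Q W (funCalc f (modular σ ρ) X) p =
      f (x p.1 * suppPow (-1) (y p.2)) * coord Q W X p := by
  have hM := (hσ.toDiagonalizes.kronecker (hρ.gpow (-1)).transpose).cfc f
  have hF : ∀ q : n × n, funCalc f (modular σ ρ) X q.1 q.2 =
      (_root_.cfc f (σ ⊗ₖ (QRE.gpow ρ (-1))ᵀ) *ᵥ fun q => X q.1 q.2) q := by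
    intro q
    rw [funCalc, modular, toMatrix_mulLeft_comp_mulRight, LinearMap.toMatrix_symm,
      ← stdBasis_repr_apply (toLin _ _ _ X) q, repr_toLin]
    congr 2
  have hc : ∀ Z : Matrix n n ℂ, ∀ q : n × n,
      ((Q ⊗ₖ Wᴴᵀ)ᴴ *ᵥ fun q => Z q.1 q.2) q = coord Q W Z q := by
    intro Z q
    rw [conjTranspose_kronecker, coord_apply, ← kronecker_transpose_mulVec]
    congr 3
    ext i j; simp
  rw [← hc]
  simp_rw [hF]
  rw [mulVec_mulVec, hM.mul_eq, ← mulVec_mulVec, mulVec_diagonal, hc]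

end Diagonalization

/-! ### Operator norm bounds -/

section OperatorNorm

open scoped Matrix.Norms.L2Operator

variable {n : Type*} [Fintype n] [DecidableEq n]

lemma opNorm_eq_norm (A : Matrix n n ℂ) : opNorm A = ‖A‖ := rfl

lemma opNorm_nonneg (A : Matrix n n ℂ) : 0 ≤ opNorm A := norm_nonneg _

lemma opNorm_conj_eq {Q W : Matrix n n ℂ} (hQ : Q ∈ unitaryGroup n ℂ) (hW : W ∈ unitaryGroup n ℂ)
    (A : Matrix n n ℂ) : opNorm (Qᴴ * A * W) = opNorm A := by
  rw [opNorm_eq_norm, opNorm_eq_norm, CStarRing.norm_mul_mem_unitary _ hW]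
  exact CStarRing.norm_mem_unitary_mul A (Unitary.star_mem hQ)

lemma sum_col_sq_le (A : Matrix n n ℂ) (j : n) : ∑ i, ‖A i j‖ ^ 2 ≤ opNorm A ^ 2 := by
  have h := l2_opNorm_mulVec A (EuclideanSpace.single j 1)
  rw [PiLp.norm_single, norm_one, mul_one] at h
  have h2 := pow_le_pow_left₀ (norm_nonneg _) h 2
  rw [EuclideanSpace.norm_sq_eq] at h2
  simpa [opNorm_eq_norm] using h2

lemma sum_row_sq_le (A : Matrix n n ℂ) (i : n) : ∑ j, ‖A i j‖ ^ 2 ≤ opNorm A ^ 2 := by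
  have h := sum_col_sq_le Aᴴ i
  rw [opNorm_eq_norm, l2_opNorm_conjTranspose] at h
  simpa [opNorm_eq_norm] using h

end OperatorNorm

section Unitary

variable {m n : Type*} [Fintype m] [Fintype n] [DecidableEq m] [DecidableEq n]

lemma Diagonalizes.mem_unitaryGroup {Q A : Matrix n n ℂ} {x : n → ℝ} (h : Diagonalizes Q x A) :
    Q ∈ unitaryGroup n ℂ :=
  mem_unitaryGroup_iff.2 h.2

lemma sum_row_sq_of_unitary {V : Matrix n n ℂ} (hV : V ∈ unitaryGroup n ℂ) (k : n) :
    ∑ l, ‖V k l‖ ^ 2 = 1 := by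
  have h := congrFun (congrFun (mem_unitaryGroup_iff.1 hV) k) k
  rw [Matrix.mul_apply, one_apply_eq] at h
  have h2 := congrArg Complex.re h
  rw [Complex.re_sum, Complex.one_re] at h2
  rw [← h2]
  refine Finset.sum_congr rfl fun l _ => ?_
  rw [star_apply, mul_comm, re_star_mul_self]

/-- The rows of `K₁` are bounded by `‖K₁ ⊗ V‖`: each row of `K₁ ⊗ V` is a row of `K₁` tensored with a
unit vector. -/
lemma sum_row_sq_le_of_kronecker [Nonempty n] {K₁ Q W : Matrix m m ℂ} {V : Matrix n n ℂ}
    (hV : V ∈ unitaryGroup n ℂ) (hQ : Q ∈ unitaryGroup m ℂ) (hW : W ∈ unitaryGroup m ℂ) (i : m) :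
    ∑ j, ‖(Qᴴ * K₁ * W) i j‖ ^ 2 ≤ opNorm (K₁ ⊗ₖ V) ^ 2 := by
  obtain ⟨k⟩ := ‹Nonempty n›
  have hQ1 : Q ⊗ₖ (1 : Matrix n n ℂ) ∈ unitaryGroup (m × n) ℂ :=
    kronecker_mem_unitary hQ (one_mem _)
  have hW1 : W ⊗ₖ (1 : Matrix n n ℂ) ∈ unitaryGroup (m × n) ℂ :=
    kronecker_mem_unitary hW (one_mem _)
  have h := sum_row_sq_le ((Q ⊗ₖ (1 : Matrix n n ℂ))ᴴ * (K₁ ⊗ₖ V) * (W ⊗ₖ 1)) (i, k)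
  rw [opNorm_conj_eq hQ1 hW1, conjTranspose_kronecker, ← mul_kronecker_mul, ← mul_kronecker_mul,
    conjTranspose_one, Matrix.one_mul, Matrix.mul_one, Fintype.sum_prod_type] at h
  simp_rw [kroneckerMap_apply, norm_mul, mul_pow, ← Finset.mul_sum, sum_row_sq_of_unitary hV k,
    mul_one] at h
  exact h

variable {Q W : Matrix n n ℂ} {x y : n → ℝ} {σ ρ : Matrix n n ℂ}

/-- The eigenvalues `λ_i / μ_j` of the modular operator, set to `0` where `μ_j = 0`. -/
noncomputable def quot (x y : n → ℝ) (p : n × n) : ℝ := x p.1 * suppPow (-1) (y p.2)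

omit [Fintype n] [DecidableEq n] in
lemma quot_apply (x y : n → ℝ) (p : n × n) : quot x y p = x p.1 * suppPow (-1) (y p.2) := rfl

lemma quot_nonneg (hσ : StateDiag Q x σ) (hρ : StateDiag W y ρ) (p : n × n) : 0 ≤ quot x y p :=
  mul_nonneg (hσ.nonneg _) (suppPow_nonneg (hρ.nonneg _) _)

lemma quasiEntropy_eq_sum (hσ : StateDiag Q x σ) (hρ : StateDiag W y ρ) (f : ℝ → ℝ)
    (K : Matrix n n ℂ) :
    quasiEntropy f K ρ σ = ∑ p, f (quot x y p) * ‖coord Q W (K * gpow ρ (1 / 2)) p‖ ^ 2 := by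
  have e : gpow ρ (1 / 2) * Kᴴ = (K * gpow ρ (1 / 2))ᴴ := by
    rw [conjTranspose_mul, hρ.gpow_conjTranspose]
  rw [quasiEntropy, e, trace_mul_re_eq_sum hσ.mul_conjTranspose_self hρ.mul_conjTranspose_self]
  refine Finset.sum_congr rfl fun p _ => ?_
  rw [coord_funCalc_modular hσ hρ, ← re_star_mul_self, quot_apply, mul_left_comm,
    Complex.re_ofReal_mul]

lemma diagMul_rpow_coord (hσ : StateDiag Q x σ) (hρ : StateDiag W y ρ) {β : ℝ} (hβ : 0 < β)
    (K : Matrix n n ℂ) :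
    diagMul (fun p => quot x y p ^ β) (coord Q W (K * gpow ρ (1 / 2))) =
      coord Q W (gpow σ β * K * gpow ρ (1 / 2 - β)) := by
  ext p
  rw [diagMul_apply, Matrix.mul_assoc, coord_mul_left (hσ.gpow β), coord_mul_right (hρ.gpow _),
    coord_mul_right (hρ.gpow _), quot_apply, Real.mul_rpow (hσ.nonneg _)
    (suppPow_nonneg (hρ.nonneg _) _), suppPow_eq_rpow hβ]
  rcases (hρ.nonneg p.2).eq_or_lt with h | h
  · simp [← h]
  · have e : (y p.2 ^ (-1 : ℝ)) ^ β * y p.2 ^ (1 / 2 : ℝ) = y p.2 ^ (1 / 2 - β) := by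
      rw [← Real.rpow_mul h.le, ← Real.rpow_add h]
      congr 1
      ring
    rw [suppPow_of_ne h.ne', suppPow_of_ne h.ne', suppPow_of_ne h.ne', ← e]
    push_cast
    ring

lemma norm_coord_le (hQ : Q ∈ unitaryGroup n ℂ) (hρ : StateDiag W y ρ) (K : Matrix n n ℂ) :
    ‖coord Q W (K * gpow ρ (1 / 2))‖ ≤ opNorm K := by
  refine le_of_sq_le_sq ?_ (opNorm_nonneg K)
  rw [EuclideanSpace.norm_sq_eq, Fintype.sum_prod_type, Finset.sum_comm]
  calc ∑ j, ∑ i, ‖coord Q W (K * gpow ρ (1 / 2)) (i, j)‖ ^ 2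
      = ∑ j, y j * ∑ i, ‖(Qᴴ * K * W) i j‖ ^ 2 := by
        refine Finset.sum_congr rfl fun j _ => ?_
        rw [Finset.mul_sum]
        refine Finset.sum_congr rfl fun i _ => ?_
        rw [coord_mul_right (hρ.gpow _), norm_mul, mul_pow, Complex.norm_real, Real.norm_eq_abs,
          sq_abs, sq, sq, suppPow_mul (hρ.nonneg _), mul_comm]
        norm_num [suppPow_one, coord_apply, sq]
    _ ≤ ∑ j, y j * opNorm K ^ 2 := by
        refine Finset.sum_le_sum fun j _ => mul_le_mul_of_nonneg_left ?_ (hρ.nonneg j)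
        rw [← opNorm_conj_eq hQ hρ.mem_unitaryGroup K]
        exact sum_col_sq_le _ j
    _ = opNorm K ^ 2 := by rw [← Finset.sum_mul, hρ.sum_eq_one, one_mul]

/-- `‖Δ(K √ρ)‖ ≤ k / r` when the rows of `K` are bounded by `k` and `r` is a lower bound of the
non-zero eigenvalues of `ρ`. -/
lemma norm_diagMul_coord_le (hσ : StateDiag Q x σ) (hρ : StateDiag W y ρ) {K : Matrix n n ℂ}
    {k r : ℝ} (hk : 0 ≤ k) (hr : 0 < r) (hry : ∀ j, y j ≠ 0 → r ≤ y j)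
    (hrow : ∀ i, ∑ j, ‖(Qᴴ * K * W) i j‖ ^ 2 ≤ k ^ 2) :
    ‖diagMul (quot x y) (coord Q W (K * gpow ρ (1 / 2)))‖ ≤ k / r := by
  have hr1 : r ≤ 1 := by
    by_contra hc
    have h0 : ∀ j, y j = 0 := fun j => by
      by_contra hj
      exact hc ((hry j hj).trans (hρ.le_one j))
    have := hρ.sum_eq_one
    simp [h0] at this
  refine le_of_sq_le_sq ?_ (by positivity)
  rw [EuclideanSpace.norm_sq_eq, Fintype.sum_prod_type]
  calc ∑ i, ∑ j, ‖diagMul (quot x y) (coord Q W (K * gpow ρ (1 / 2))) (i, j)‖ ^ 2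
      ≤ ∑ i, x i * (r⁻¹ * ∑ j, ‖(Qᴴ * K * W) i j‖ ^ 2) := by
        refine Finset.sum_le_sum fun i _ => ?_
        rw [Finset.mul_sum, Finset.mul_sum]
        refine Finset.sum_le_sum fun j _ => ?_
        have hx : x i ^ 2 ≤ x i := by
          nlinarith [hσ.nonneg i, hσ.le_one i]
        have hy : suppPow (-1) (y j) ≤ r⁻¹ := by
          by_cases h : y j = 0
          · rw [h, suppPow_zero]; positivity
          · rw [suppPow_of_ne h, Real.rpow_neg_one]
            exact inv_anti₀ hr (hry j h)
        have e : suppPow (-1) (y j) * suppPow (1 / 2) (y j) = suppPow (-(1 / 2)) (y j) := by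
          rw [suppPow_mul (hρ.nonneg j)]; norm_num
        have e2 : (suppPow (-1) (y j) * suppPow (1 / 2) (y j)) ^ 2 = suppPow (-1) (y j) := by
          rw [e, sq, suppPow_mul (hρ.nonneg j)]; norm_num
        have e3 : ‖diagMul (quot x y) (coord Q W (K * gpow ρ (1 / 2))) (i, j)‖ ^ 2 =
            x i ^ 2 * (suppPow (-1) (y j) * ‖(Qᴴ * K * W) i j‖ ^ 2) := by
          rw [diagMul_apply, coord_mul_right (hρ.gpow _), norm_mul, norm_mul, Complex.norm_real,
            Complex.norm_real, Real.norm_eq_abs, Real.norm_eq_abs, mul_pow, mul_pow, sq_abs, sq_abs,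
            quot_apply, mul_pow, coord_apply]
          linear_combination (x i ^ 2 * ‖(Qᴴ * K * W) i j‖ ^ 2) * e2
        rw [e3]
        have := suppPow_nonneg (hρ.nonneg j) (-1)
        have := hσ.nonneg i
        gcongr
    _ ≤ ∑ i, x i * (r⁻¹ * k ^ 2) := by
        refine Finset.sum_le_sum fun i _ => mul_le_mul_of_nonneg_left ?_ (hσ.nonneg i)
        gcongr
        exact hrow i
    _ = r⁻¹ * k ^ 2 := by rw [← Finset.sum_mul, hσ.sum_eq_one, one_mul]
    _ ≤ (k / r) ^ 2 := by
        rw [div_pow, div_eq_inv_mul]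
        gcongr
        nlinarith

lemma coord_eq_zero_of_quot_eq_zero (hσ : StateDiag Q x σ) (hρ : StateDiag W y ρ)
    {K : Matrix n n ℂ} (hker : ∀ v : n → ℂ, σ *ᵥ v = 0 → (ρ * Kᴴ) *ᵥ v = 0) (p : n × n)
    (hp : quot x y p = 0) : coord Q W (K * gpow ρ (1 / 2)) p = 0 := by
  rw [coord_mul_right (hρ.gpow _)]
  by_cases hy : y p.2 = 0
  · simp [hy]
  have hx : x p.1 = 0 := by
    rw [quot_apply, suppPow_of_ne hy] at hp
    rcases mul_eq_zero.1 hp with h | h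
    · exact h
    · exact absurd h (Real.rpow_pos_of_pos (lt_of_le_of_ne (hρ.nonneg _) (Ne.symm hy)) _).ne'
  have h1 : σ *ᵥ (fun i => Q i p.1) = 0 := by
    funext i
    have := congrFun (congrFun hσ.eq_mul i) p.1
    rw [mul_diagonal, hx, Complex.ofReal_zero, mul_zero] at this
    exact this
  have h2 : ∀ i, (ρ * Kᴴ * Q) i p.1 = 0 := fun i => congrFun (hker _ h1) i
  have h3 : (Wᴴ * (ρ * Kᴴ * Q)) p.2 p.1 = 0 := by
    rw [Matrix.mul_apply]
    exact Finset.sum_eq_zero fun i _ => by rw [h2, mul_zero]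
  have e : Wᴴ * (ρ * Kᴴ * Q) = diagonal (fun i => (y i : ℂ)) * (Qᴴ * K * W)ᴴ := by
    rw [conjTranspose_mul, conjTranspose_mul, conjTranspose_conjTranspose, ← Matrix.mul_assoc,
      ← Matrix.mul_assoc, hρ.mul_eq]
    simp only [Matrix.mul_assoc]
  rw [e, diagonal_mul, conjTranspose_apply] at h3
  have h4 : star ((Qᴴ * K * W) p.1 p.2) = 0 :=
    (mul_eq_zero.1 h3).resolve_left (by exact_mod_cast hy)
  rw [coord_apply, star_eq_zero.1 h4, zero_mul]

end Unitary

/-! ### Partial traces -/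

section PartialTrace

variable {m n : Type*} [Fintype m] [Fintype n] [DecidableEq m] [DecidableEq n]

omit [Fintype m] [DecidableEq m] [DecidableEq n] in
lemma ptrace_eq_sum (X : Matrix (m × n) (m × n) ℂ) :
    ptrace X = ∑ k : n, X.submatrix (fun i => (i, k)) (fun i => (i, k)) := by
  ext i j
  simp [ptrace, Matrix.sum_apply]

omit [Fintype m] [DecidableEq m] [DecidableEq n] in
lemma ptrace_posSemidef {X : Matrix (m × n) (m × n) ℂ} (h : X.PosSemidef) :
    (ptrace X).PosSemidef := by
  rw [ptrace_eq_sum]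
  exact posSemidef_sum _ fun k _ => h.submatrix _

omit [DecidableEq m] [DecidableEq n] in
lemma trace_ptrace (X : Matrix (m × n) (m × n) ℂ) : (ptrace X).trace = X.trace := by
  simp [Matrix.trace, ptrace, Fintype.sum_prod_type]

omit [DecidableEq m] [DecidableEq n] in
lemma IsState.ptrace {ρ : Matrix (m × n) (m × n) ℂ} (h : IsState ρ) : IsState (ptrace ρ) :=
  ⟨ptrace_posSemidef h.1, by rw [trace_ptrace, h.2]⟩

omit [DecidableEq m] in
lemma trace_mul_amp (X : Matrix (m × n) (m × n) ℂ) (Y : Matrix m m ℂ) :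
    (X * amp n Y).trace = (ptrace X * Y).trace := by
  simp only [Matrix.trace, diag_apply, Matrix.mul_apply, Fintype.sum_prod_type, amp,
    kroneckerMap_apply, ptrace, of_apply, Finset.sum_mul, one_apply, mul_ite, mul_one, mul_zero]
  refine Finset.sum_congr rfl fun i _ => ?_
  rw [Finset.sum_comm]
  simp

omit [Fintype m] [Fintype n] [DecidableEq m] in
lemma amp_conjTranspose (Y : Matrix m m ℂ) : (amp n Y)ᴴ = amp n Yᴴ := by
  rw [amp, conjTranspose_kronecker, conjTranspose_one, amp]

omit [DecidableEq m] in
lemma amp_mul_amp (X Y : Matrix m m ℂ) : amp n X * amp n Y = amp n (X * Y) := by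
  rw [amp, amp, ← mul_kronecker_mul, Matrix.one_mul, amp]

omit [DecidableEq m] in
lemma kronecker_mul_amp (X Y : Matrix m m ℂ) (V : Matrix n n ℂ) :
    (X ⊗ₖ V) * amp n Y = (X * Y) ⊗ₖ V := by
  rw [amp, ← mul_kronecker_mul, Matrix.mul_one]

omit [DecidableEq m] in
lemma amp_mul_kronecker (X Y : Matrix m m ℂ) (V : Matrix n n ℂ) :
    amp n X * (Y ⊗ₖ V) = (X * Y) ⊗ₖ V := by
  rw [amp, ← mul_kronecker_mul, Matrix.one_mul]

omit [DecidableEq m] in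
lemma conjTranspose_kronecker_mul {V : Matrix n n ℂ} (hV : V ∈ unitaryGroup n ℂ)
    (X Y : Matrix m m ℂ) : (X ⊗ₖ V)ᴴ * (Y ⊗ₖ V) = amp n (Xᴴ * Y) := by
  rw [conjTranspose_kronecker, ← mul_kronecker_mul, amp]
  congr 1
  exact mem_unitaryGroup_iff'.1 hV

omit [DecidableEq m] in
lemma kronecker_mul_conjTranspose {V : Matrix n n ℂ} (hV : V ∈ unitaryGroup n ℂ)
    (X Y : Matrix m m ℂ) : (X ⊗ₖ V) * (Y ⊗ₖ V)ᴴ = amp n (X * Yᴴ) := by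
  rw [conjTranspose_kronecker, ← mul_kronecker_mul, amp]
  congr 1
  exact mem_unitaryGroup_iff.1 hV

/-- The support of `ρ` is contained in the support of `ρ₁ ⊗ 1`. -/
lemma amp_gpow_zero_mul {ρ : Matrix (m × n) (m × n) ℂ} {W : Matrix (m × n) (m × n) ℂ}
    {y : m × n → ℝ} (hρ : StateDiag W y ρ) {W₁ : Matrix m m ℂ} {y₁ : m → ℝ}
    (hρ₁ : StateDiag W₁ y₁ (ptrace ρ)) :
    amp n (gpow (ptrace ρ) 0) * gpow ρ (1 / 2) = gpow ρ (1 / 2) := by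
  set Z := 1 - gpow (ptrace ρ) 0 with hZ
  have hZH : Zᴴ = Z := by
    rw [hZ, conjTranspose_sub, conjTranspose_one, hρ₁.gpow_conjTranspose]
  have hρZ : ptrace ρ * Z = 0 := by
    have := hρ₁.gpow_mul 1 0
    rw [add_zero, hρ₁.gpow_one] at this
    rw [hZ, Matrix.mul_sub, Matrix.mul_one, this, sub_self]
  have h0 : amp n Z * gpow ρ (1 / 2) = 0 := by
    rw [← trace_mul_conjTranspose_self_eq_zero_iff, conjTranspose_mul, hρ.gpow_conjTranspose,
      amp_conjTranspose, hZH, Matrix.mul_assoc, ← Matrix.mul_assoc (gpow ρ _), hρ.gpow_mul,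
      trace_mul_comm, Matrix.mul_assoc, amp_mul_amp, show (1 / 2 + 1 / 2 : ℝ) = 1 by norm_num,
      hρ.gpow_one, trace_mul_amp, ← Matrix.mul_assoc, hρZ, Matrix.zero_mul, trace_zero]
  have e : amp n Z = 1 - amp n (gpow (ptrace ρ) 0) := by
    rw [amp, amp, eq_sub_iff_add_eq, ← add_kronecker, hZ, sub_add_cancel, one_kronecker_one]
  rw [e, Matrix.sub_mul, Matrix.one_mul, sub_eq_zero] at h0
  exact h0.symm

omit [DecidableEq m] in
/-- The kernel condition for the finiteness of the entropy passes to the reduced states. -/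
lemma ker_condition_ptrace {ρ σ : Matrix (m × n) (m × n) ℂ} (hσ : σ.PosSemidef)
    {K₁ : Matrix m m ℂ} {V : Matrix n n ℂ} (hV : V ∈ unitaryGroup n ℂ)
    (h : ∀ v : m × n → ℂ, σ *ᵥ v = 0 → (ρ * (K₁ ⊗ₖ V)ᴴ) *ᵥ v = 0) (v : m → ℂ)
    (hv : ptrace σ *ᵥ v = 0) : (ptrace ρ * K₁ᴴ) *ᵥ v = 0 := by
  -- `σ` annihilates `v ⊗ e_k`, since its expectations sum to that of `σ₁`
  have hs : ∀ k : n, σ *ᵥ (fun p => v p.1 * (1 : Matrix n n ℂ) p.2 k) = 0 := by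
    have hsum : ∑ k : n, star (fun p : m × n => v p.1 * (1 : Matrix n n ℂ) p.2 k) ⬝ᵥ
        σ *ᵥ (fun p => v p.1 * (1 : Matrix n n ℂ) p.2 k) = star v ⬝ᵥ ptrace σ *ᵥ v := by
      simp only [dotProduct, mulVec, Fintype.sum_prod_type, Pi.star_apply, ptrace, of_apply,
        one_apply, mul_ite, mul_one, mul_zero, Finset.sum_ite_eq', Finset.mem_univ, if_true,
        Finset.sum_mul, apply_ite star, star_zero, ite_mul, zero_mul]
      rw [Finset.sum_comm]
      refine Finset.sum_congr rfl fun i _ => ?_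
      rw [← Finset.mul_sum, Finset.sum_comm]
    rw [hv, dotProduct_zero] at hsum
    have hnn : ∀ k ∈ Finset.univ, 0 ≤ star (fun p : m × n => v p.1 * (1 : Matrix n n ℂ) p.2 k) ⬝ᵥ
        σ *ᵥ (fun p => v p.1 * (1 : Matrix n n ℂ) p.2 k) :=
      fun k _ => hσ.dotProduct_mulVec_nonneg _
    intro k
    exact (hσ.dotProduct_mulVec_zero_iff _).1
      ((Finset.sum_eq_zero_iff_of_nonneg hnn).1 hsum k (Finset.mem_univ k))
  -- the matrix with columns `v ⊗ e_k` turns this into matrix identities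
  set Z : Matrix (m × n) n ℂ := Matrix.of fun p k => v p.1 * (1 : Matrix n n ℂ) p.2 k with hZ
  have h1 : (ρ * (K₁ ⊗ₖ V)ᴴ) * Z = 0 := by
    ext p k
    exact congrFun (h _ (hs k)) p
  have h2 : (K₁ ⊗ₖ V)ᴴ * Z * V = Matrix.of fun p k => (K₁ᴴ *ᵥ v) p.1 * (1 : Matrix n n ℂ) p.2 k := by
    have hVV : Vᴴ * V = 1 := mem_unitaryGroup_iff'.1 hV
    ext p k
    have e : ((K₁ ⊗ₖ V)ᴴ * Z) = Matrix.of fun p k => (K₁ᴴ *ᵥ v) p.1 * Vᴴ p.2 k := by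
      ext p k
      simp only [hZ, Matrix.mul_apply, conjTranspose_kronecker, kroneckerMap_apply, of_apply,
        Fintype.sum_prod_type, one_apply, mul_ite, mul_one, mul_zero, Finset.sum_ite_eq',
        Finset.mem_univ, if_true, mulVec, dotProduct, Finset.sum_mul]
      exact Finset.sum_congr rfl fun i _ => by ring
    rw [e, ← hVV]
    simp only [Matrix.mul_apply, of_apply, mul_assoc, Finset.mul_sum]
  have h3 : ρ * ((K₁ ⊗ₖ V)ᴴ * Z * V) = 0 := by
    rw [← Matrix.mul_assoc, ← Matrix.mul_assoc, h1, Matrix.zero_mul]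
  rw [h2] at h3
  rw [← mulVec_mulVec]
  funext i
  have h4 : ∑ k : n, (ρ * Matrix.of fun (p : m × n) (k : n) =>
      (K₁ᴴ *ᵥ v) p.1 * (1 : Matrix n n ℂ) p.2 k) (i, k) k = 0 := by rw [h3]; simp
  rw [Pi.zero_apply, ← h4]
  generalize K₁ᴴ *ᵥ v = u
  simp only [Matrix.mul_apply, of_apply, Fintype.sum_prod_type, one_apply, mul_ite, mul_one,
    mul_zero, Finset.sum_ite_eq', Finset.mem_univ, if_true, mulVec, dotProduct, ptrace,
    Finset.sum_mul]
  rw [Finset.sum_comm]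

/-- Compression of an invertible state: its smallest eigenvalue bounds the eigenvalues of the
reduced state from below. -/
lemma minNonzeroEigenvalue_le_of_posDef [Nonempty n] {ρ : Matrix (m × n) (m × n) ℂ}
    (hpos : ρ.PosDef) {W : Matrix (m × n) (m × n) ℂ} {y : m × n → ℝ} (hρ : StateDiag W y ρ)
    {W₁ : Matrix m m ℂ} {y₁ : m → ℝ} (hρ₁ : StateDiag W₁ y₁ (ptrace ρ)) (j : m) :
    minNonzeroEigenvalue ρ ≤ y₁ j := by
  set r := minNonzeroEigenvalue ρ with hr
  have hy : ∀ i, r ≤ y i := fun i => hρ.minNonzeroEigenvalue_le fun h0 => by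
    have : (0 : ℝ) ∈ spectrum ℝ ρ := hρ.spectrum_eq ▸ ⟨i, h0⟩
    exact spectrum.zero_notMem ℝ hpos.isUnit this
  have hd := (hρ.toDiagonalizes.add (hρ.toDiagonalizes.one.smul (-r)))
  have hps : (ρ + (-r) • (1 : Matrix (m × n) (m × n) ℂ)).PosSemidef := by
    rw [hd.eq]
    refine PosSemidef.mul_mul_conjTranspose_same (posSemidef_diagonal_iff.2 fun i => ?_) _
    have := hy i
    exact_mod_cast (by linarith : (0 : ℝ) ≤ y i + -r * 1)
  have e : ptrace (ρ + (-r) • (1 : Matrix (m × n) (m × n) ℂ)) =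
      ptrace ρ + (-r * Fintype.card n) • (1 : Matrix m m ℂ) := by
    ext i k
    by_cases hik : i = k
    · simp [ptrace, hik, Finset.sum_add_distrib, mul_comm]
    · simp [ptrace, hik, Finset.sum_add_distrib, one_apply]
  have h1 := ((ptrace_posSemidef hps).conjTranspose_mul_mul_same W₁).diag_nonneg (i := j)
  rw [e, (hρ₁.toDiagonalizes.add (hρ₁.toDiagonalizes.one.smul (-r * Fintype.card n))).mul_eq,
    Matrix.mul_assoc, hρ₁.conjTranspose_mul_self, Matrix.mul_one, diagonal_apply_eq] at h1
  have h2 : 0 ≤ y₁ j + -r * Fintype.card n * 1 := by exact_mod_cast h1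
  have h3 : (1 : ℝ) ≤ Fintype.card n := by exact_mod_cast Fintype.card_pos
  have h4 : 0 < r := hρ.minNonzeroEigenvalue_pos
  nlinarith

end PartialTrace

/-! ### The contraction intertwining the two modular operators -/

section Transfer

variable {m n : Type*} [Fintype m] [Fintype n] [DecidableEq m] [DecidableEq n]

omit [DecidableEq n] in
lemma coord_add (Q W X Y : Matrix n n ℂ) : coord Q W (X + Y) = coord Q W X + coord Q W Y := by
  ext p
  simp [coord_apply, Matrix.mul_add, Matrix.add_mul]

omit [DecidableEq n] in
lemma coord_smul (Q W X : Matrix n n ℂ) (a : ℂ) : coord Q W (a • X) = a • coord Q W X := by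
  ext p
  simp [coord_apply]

omit [DecidableEq n] in
lemma coord_sub (Q W X Y : Matrix n n ℂ) : coord Q W (X - Y) = coord Q W X - coord Q W Y := by
  ext p
  simp [coord_apply, Matrix.mul_sub, Matrix.sub_mul]

/-- The map `X ↦ (X ⊗ V) ρ₁^{-1/2} ρ^{1/2}` in the coordinates of the eigenbases: `Q`, `W` for `σ`,
`ρ` and `Q₁`, `W₁` for their partial traces. -/
noncomputable def transfer (Q W : Matrix (m × n) (m × n) ℂ) (Q₁ W₁ : Matrix m m ℂ)
    (V : Matrix n n ℂ) (ρ : Matrix (m × n) (m × n) ℂ) :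
    EuclideanSpace ℂ (m × m) →ₗ[ℂ] EuclideanSpace ℂ ((m × n) × (m × n)) where
  toFun v := coord Q W
    (((Q₁ * (Matrix.of fun i j => v (i, j)) * W₁ᴴ) ⊗ₖ V) *
      amp n (gpow (ptrace ρ) (-(1 / 2))) * gpow ρ (1 / 2))
  map_add' v w := by
    have e : (Matrix.of fun i j => (v + w) (i, j)) =
        (Matrix.of fun i j => v (i, j)) + Matrix.of fun i j => w (i, j) := rfl
    rw [e, Matrix.mul_add, Matrix.add_mul, add_kronecker, Matrix.add_mul, Matrix.add_mul, coord_add]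
  map_smul' a v := by
    have e : (Matrix.of fun i j => (a • v) (i, j)) =
        a • (Matrix.of fun i j => v (i, j)) := rfl
    rw [e, Matrix.mul_smul, Matrix.smul_mul, smul_kronecker, Matrix.smul_mul, Matrix.smul_mul,
      coord_smul, RingHom.id_apply]

variable {Q W : Matrix (m × n) (m × n) ℂ} {x y : m × n → ℝ} {σ ρ : Matrix (m × n) (m × n) ℂ}
  {Q₁ W₁ : Matrix m m ℂ} {x₁ y₁ : m → ℝ} {V : Matrix n n ℂ}

lemma transfer_coord (hσ₁ : StateDiag Q₁ x₁ (ptrace σ)) (hρ₁ : StateDiag W₁ y₁ (ptrace ρ))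
    (X : Matrix m m ℂ) :
    transfer Q W Q₁ W₁ V ρ (coord Q₁ W₁ X) =
      coord Q W (((X * gpow (ptrace ρ) (-(1 / 2))) ⊗ₖ V) * gpow ρ (1 / 2)) := by
  have e : Q₁ * (Matrix.of fun i j => coord Q₁ W₁ X (i, j)) * W₁ᴴ = X := by
    have : (Matrix.of fun i j => coord Q₁ W₁ X (i, j)) = Q₁ᴴ * X * W₁ := rfl
    rw [this, ← Matrix.mul_assoc, ← Matrix.mul_assoc, hσ₁.mul_conjTranspose_self, Matrix.one_mul,
      Matrix.mul_assoc, hρ₁.mul_conjTranspose_self, Matrix.mul_one]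
  change coord Q W (((Q₁ * (Matrix.of fun i j => coord Q₁ W₁ X (i, j)) * W₁ᴴ) ⊗ₖ V) *
      amp n (gpow (ptrace ρ) (-(1 / 2))) * gpow ρ (1 / 2)) = _
  rw [e, kronecker_mul_amp]

omit [DecidableEq n] in
lemma exists_coord_eq (hσ₁ : StateDiag Q₁ x₁ (ptrace σ)) (hρ₁ : StateDiag W₁ y₁ (ptrace ρ))
    (v : EuclideanSpace ℂ (m × m)) : ∃ X : Matrix m m ℂ, coord Q₁ W₁ X = v := by
  refine ⟨Q₁ * (Matrix.of fun i j => v (i, j)) * W₁ᴴ, ?_⟩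
  ext p
  rw [coord_apply, ← Matrix.mul_assoc, ← Matrix.mul_assoc, hσ₁.conjTranspose_mul_self,
    Matrix.one_mul, Matrix.mul_assoc, hρ₁.conjTranspose_mul_self, Matrix.mul_one]
  rfl

lemma trace_mul_gpow_half {W ρ : Matrix n n ℂ} {y : n → ℝ} (hρ : StateDiag W y ρ)
    (X Y : Matrix n n ℂ) :
    ((X * gpow ρ (1 / 2))ᴴ * (Y * gpow ρ (1 / 2))).trace = (ρ * (Xᴴ * Y)).trace := by
  rw [conjTranspose_mul, hρ.gpow_conjTranspose, Matrix.mul_assoc, trace_mul_comm,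
    ← Matrix.mul_assoc Xᴴ, Matrix.mul_assoc, hρ.gpow_mul,
    show (1 / 2 + 1 / 2 : ℝ) = 1 by norm_num, hρ.gpow_one, trace_mul_comm]

lemma trace_kronecker_mul_gpow_half (hρ : StateDiag W y ρ) (hV : V ∈ unitaryGroup n ℂ)
    (X Y : Matrix m m ℂ) :
    (((X ⊗ₖ V) * gpow ρ (1 / 2))ᴴ * ((Y ⊗ₖ V) * gpow ρ (1 / 2))).trace =
      (ptrace ρ * (Xᴴ * Y)).trace := by
  rw [trace_mul_gpow_half hρ, conjTranspose_kronecker_mul hV, trace_mul_amp]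

lemma transfer_kronecker (hρ : StateDiag W y ρ) (hσ₁ : StateDiag Q₁ x₁ (ptrace σ))
    (hρ₁ : StateDiag W₁ y₁ (ptrace ρ)) (K₁ : Matrix m m ℂ) :
    transfer Q W Q₁ W₁ V ρ (coord Q₁ W₁ (K₁ * gpow (ptrace ρ) (1 / 2))) =
      coord Q W ((K₁ ⊗ₖ V) * gpow ρ (1 / 2)) := by
  rw [transfer_coord hσ₁ hρ₁, Matrix.mul_assoc K₁, hρ₁.gpow_mul,
    show (1 / 2 + -(1 / 2) : ℝ) = 0 by norm_num, ← kronecker_mul_amp, Matrix.mul_assoc,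
    amp_gpow_zero_mul hρ hρ₁]

/-- The modular operators of two states and of their reductions are intertwined by `transfer`. -/
lemma intertwined_transfer (hσ : StateDiag Q x σ) (hρ : StateDiag W y ρ)
    (hσ₁ : StateDiag Q₁ x₁ (ptrace σ)) (hρ₁ : StateDiag W₁ y₁ (ptrace ρ))
    (hV : V ∈ unitaryGroup n ℂ) (K₁ : Matrix m m ℂ) :
    Intertwined (quot x y) (quot x₁ y₁) (transfer Q W Q₁ W₁ V ρ)
      (coord Q W ((K₁ ⊗ₖ V) * gpow ρ (1 / 2)))
      (coord Q₁ W₁ (K₁ * gpow (ptrace ρ) (1 / 2))) where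
  nonneg := quot_nonneg hσ hρ
  nonneg₁ := quot_nonneg hσ₁ hρ₁
  map_eq := transfer_kronecker hρ hσ₁ hρ₁ K₁
  contr v := by
    obtain ⟨X, rfl⟩ := exists_coord_eq hσ₁ hρ₁ v
    rw [transfer_coord hσ₁ hρ₁, ← trace_self_re_eq_sum hσ.mul_conjTranspose_self
      hρ.mul_conjTranspose_self, trace_kronecker_mul_gpow_half hρ hV]
    rw [← trace_mul_gpow_half hρ₁, Matrix.mul_assoc, hρ₁.gpow_mul,
      trace_self_re_eq_sum hσ₁.mul_conjTranspose_self hρ₁.mul_conjTranspose_self]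
    refine Finset.sum_le_sum fun p _ => ?_
    rw [coord_mul_right (hρ₁.gpow _), norm_mul, mul_pow]
    refine mul_le_of_le_one_right (by positivity) ?_
    by_cases h : y₁ p.2 = 0
    · simp [h]
    · simp [suppPow_of_ne h]
  form_le v := by
    obtain ⟨X, rfl⟩ := exists_coord_eq hσ₁ hρ₁ v
    rw [transfer_coord hσ₁ hρ₁]
    set X' := X * gpow (ptrace ρ) (-(1 / 2)) with hX'
    calc ∑ p, quot x y p * ‖coord Q W ((X' ⊗ₖ V) * gpow ρ (1 / 2)) p‖ ^ 2
        ≤ ∑ p, x p.1 * ‖coord Q W (X' ⊗ₖ V) p‖ ^ 2 := by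
          refine Finset.sum_le_sum fun p _ => ?_
          rw [coord_mul_right (hρ.gpow _), norm_mul, mul_pow, Complex.norm_real, Real.norm_eq_abs,
            sq_abs, quot_apply, sq (suppPow _ _), suppPow_mul (hρ.nonneg _), mul_assoc]
          refine mul_le_mul_of_nonneg_left ?_ (hσ.nonneg _)
          rw [mul_left_comm, suppPow_mul (hρ.nonneg _)]
          refine mul_le_of_le_one_right (by positivity) ?_
          by_cases h : y p.2 = 0
          · simp [h]
          · rw [suppPow_of_ne h]; norm_num
      _ = ((X' ⊗ₖ V)ᴴ * (σ * (X' ⊗ₖ V))).trace.re := by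
          rw [trace_mul_re_eq_sum hσ.mul_conjTranspose_self hρ.mul_conjTranspose_self]
          refine Finset.sum_congr rfl fun p _ => ?_
          rw [coord_mul_left hσ.toDiagonalizes, mul_left_comm, Complex.re_ofReal_mul,
            re_star_mul_self]
      _ = (X'ᴴ * (ptrace σ * X')).trace.re := by
          rw [trace_mul_comm, Matrix.mul_assoc, kronecker_mul_conjTranspose hV, trace_mul_amp,
            ← Matrix.mul_assoc, trace_mul_comm (ptrace σ * X')]
      _ = ∑ p, quot x₁ y₁ p * ‖coord Q₁ W₁ X p‖ ^ 2 := by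
          rw [trace_mul_re_eq_sum hσ₁.mul_conjTranspose_self hρ₁.mul_conjTranspose_self]
          refine Finset.sum_congr rfl fun p _ => ?_
          rw [coord_mul_left hσ₁.toDiagonalizes, mul_left_comm, Complex.re_ofReal_mul,
            re_star_mul_self, hX', coord_mul_right (hρ₁.gpow _), norm_mul, mul_pow,
            Complex.norm_real, Real.norm_eq_abs, sq_abs, sq (suppPow _ _),
            suppPow_mul (hρ₁.nonneg _), quot_apply, show (-(1 / 2) + -(1 / 2) : ℝ) = -1 by norm_num]
          ring
  adjoint v := by
    obtain ⟨X, rfl⟩ := exists_coord_eq hσ₁ hρ₁ v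
    have e : ptrace ρ * gpow (ptrace ρ) (-(1 / 2)) = gpow (ptrace ρ) (1 / 2) := by
      have := hρ₁.gpow_mul 1 (-(1 / 2))
      rw [hρ₁.gpow_one] at this
      rw [this]
      norm_num
    rw [transfer_coord hσ₁ hρ₁, ← trace_mul_re_eq_sum hσ.mul_conjTranspose_self
      hρ.mul_conjTranspose_self, ← trace_mul_re_eq_sum hσ₁.mul_conjTranspose_self
      hρ₁.mul_conjTranspose_self, trace_kronecker_mul_gpow_half hρ hV, conjTranspose_mul,
      hρ₁.gpow_conjTranspose, Matrix.mul_assoc (gpow _ _), ← Matrix.mul_assoc (ptrace ρ), e,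
      trace_mul_comm, Matrix.mul_assoc]

lemma coord_remainder (hσ : StateDiag Q x σ) (hρ : StateDiag W y ρ)
    (hσ₁ : StateDiag Q₁ x₁ (ptrace σ)) (hρ₁ : StateDiag W₁ y₁ (ptrace ρ)) {β : ℝ} (hβ : 0 < β)
    (K₁ : Matrix m m ℂ) :
    coord Q W (remainder β (K₁ ⊗ₖ V) ρ σ) =
      transfer Q W Q₁ W₁ V ρ (diagMul (fun p => quot x₁ y₁ p ^ β)
        (coord Q₁ W₁ (K₁ * gpow (ptrace ρ) (1 / 2)))) -
      diagMul (fun p => quot x y p ^ β) (coord Q W ((K₁ ⊗ₖ V) * gpow ρ (1 / 2))) := by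
  rw [diagMul_rpow_coord hσ₁ hρ₁ hβ, diagMul_rpow_coord hσ hρ hβ, transfer_coord hσ₁ hρ₁,
    Matrix.mul_assoc (_ * K₁), hρ₁.gpow_mul, show (1 / 2 - β + -(1 / 2) : ℝ) = -β by ring,
    remainder, amp_mul_kronecker, kronecker_mul_amp, coord_sub]

end Transfer

end QRE

open QRE in
theorem corollary4p3 {m n : Type*} [Fintype m] [Fintype n] [DecidableEq m] [DecidableEq n]
    (f : ℝ → ℝ) (hf : QRE.IsRegular f) (hf1 : f 1 = 0)
    (β : ℝ) (hβ0 : 0 < β) (hβ1 : β < 1)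
    (c C : ℝ) (hc : 0 < c) (hC : 0 < C)
    (hreg : ∀ T : ℝ, 0 < T → QRE.regConst f T β ≤ ENNReal.ofReal (C * T ^ (2 * c)))
    (K₁ : Matrix m m ℂ) (V : Matrix n n ℂ) (hV : V ∈ Matrix.unitaryGroup n ℂ)
    (K : Matrix (m × n) (m × n) ℂ) (hK : K = K₁ ⊗ₖ V)
    (ρ σ : Matrix (m × n) (m × n) ℂ) (hρ : QRE.IsState ρ) (hσ : QRE.IsState σ)
    (hfin : QRE.EntropyFinite f K ρ σ)
    (D : ℝ) (hD : D = QRE.quasiEntropy f K ρ σ -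
      QRE.quasiEntropy f K₁ (QRE.ptrace ρ) (QRE.ptrace σ)) :
    0 ≤ D ∧
    (ρ.PosDef →
      QRE.hsNorm (QRE.remainder β K ρ σ) ≤
        QRE.constM (QRE.minNonzeroEigenvalue ρ) β (QRE.opNorm K) C * D ^ QRE.expo β c) ∧
    QRE.hsNorm (QRE.remainder β K ρ σ) ≤
      QRE.constM (min (QRE.minNonzeroEigenvalue ρ) (QRE.minNonzeroEigenvalue (QRE.ptrace ρ)))
        β (QRE.opNorm K) C * D ^ QRE.expo β c ∧
    (ρ.PosDef → β = 1 / 2 →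
      QRE.hsNorm (QRE.amp n (QRE.gpow (QRE.ptrace σ) (1 / 2)) * K *
          QRE.amp n (QRE.gpow (QRE.ptrace ρ) (-(1 / 2))) * QRE.gpow ρ (1 / 2) -
          QRE.gpow σ (1 / 2) * K) ≤
        QRE.constM (QRE.minNonzeroEigenvalue ρ) (1 / 2) (QRE.opNorm K) C *
          D ^ (1 / (4 * (1 + c)))) := by
  subst hK
  obtain ⟨Q, x, hσd⟩ := hσ.exists_stateDiag
  obtain ⟨W, y, hρd⟩ := hρ.exists_stateDiag
  obtain ⟨Q₁, x₁, hσ₁⟩ := hσ.ptrace.exists_stateDiag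
  obtain ⟨W₁, y₁, hρ₁⟩ := hρ.ptrace.exists_stateDiag
  have hne : Nonempty n := by
    rcases isEmpty_or_nonempty n with h | h
    · have := hρd.sum_eq_one
      simp at this
    · exact h
  rw [quasiEntropy_eq_sum hσd hρd, quasiEntropy_eq_sum hσ₁ hρ₁] at hD
  have hfin' : Filter.Tendsto f (𝓝[>] 0) (𝓝 (f 0)) ∨
      (∀ p, quot x y p = 0 → coord Q W ((K₁ ⊗ₖ V) * gpow ρ (1 / 2)) p = 0) ∧
      (∀ p, quot x₁ y₁ p = 0 → coord Q₁ W₁ (K₁ * gpow (ptrace ρ) (1 / 2)) p = 0) :=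
    Or.imp_right (fun h => ⟨coord_eq_zero_of_quot_eq_zero hσd hρd h,
      coord_eq_zero_of_quot_eq_zero hσ₁ hρ₁ (ker_condition_ptrace hσ.1 hV h)⟩) hfin
  obtain ⟨hD0, hmain⟩ := (intertwined_transfer hσd hρd hσ₁ hρ₁ hV K₁).norm_rpow_sub_le_entropy hf
    hβ0 hβ1 hc hC hreg hfin' hD
  have bound : ∀ r : ℝ, 0 < r → (∀ j, y j ≠ 0 → r ≤ y j) → (∀ j, y₁ j ≠ 0 → r ≤ y₁ j) →
      hsNorm (remainder β (K₁ ⊗ₖ V) ρ σ) ≤ constM r β (opNorm (K₁ ⊗ₖ V)) C * D ^ expo β c := by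
    intro r hr hry hry₁
    rw [hsNorm_eq_norm_coord hσd.mul_conjTranspose_self hρd.mul_conjTranspose_self,
      coord_remainder hσd hρd hσ₁ hρ₁ hβ0]
    refine hmain r _ (norm_coord_le hσd.mem_unitaryGroup hρd _)
      (norm_diagMul_coord_le hσd hρd (opNorm_nonneg _) hr hry fun i => ?_)
      (norm_diagMul_coord_le hσ₁ hρ₁ (opNorm_nonneg _) hr hry₁
        (sum_row_sq_le_of_kronecker hV hσ₁.mem_unitaryGroup hρ₁.mem_unitaryGroup))
    rw [← opNorm_conj_eq hσd.mem_unitaryGroup hρd.mem_unitaryGroup]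
    exact sum_row_sq_le _ i
  have boundPos : ρ.PosDef → hsNorm (remainder β (K₁ ⊗ₖ V) ρ σ) ≤
      constM (minNonzeroEigenvalue ρ) β (opNorm (K₁ ⊗ₖ V)) C * D ^ expo β c := fun hpos =>
    bound _ hρd.minNonzeroEigenvalue_pos (fun _ hj => hρd.minNonzeroEigenvalue_le hj)
      fun j _ => minNonzeroEigenvalue_le_of_posDef hpos hρd hρ₁ j
  refine ⟨hD0, boundPos, bound _
    (lt_min hρd.minNonzeroEigenvalue_pos hρ₁.minNonzeroEigenvalue_pos)
    (fun j hj => (min_le_left _ _).trans (hρd.minNonzeroEigenvalue_le hj))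
    (fun j hj => (min_le_right _ _).trans (hρ₁.minNonzeroEigenvalue_le hj)), ?_⟩
  rintro hpos rfl
  have h1 : gpow ρ 0 = 1 := by
    have h := hρd.gpow_mul 0 1
    rw [zero_add, hρd.gpow_one] at h
    exact hpos.isUnit.mul_right_cancel (h.trans (Matrix.one_mul ρ).symm)
  have h := boundPos hpos
  rw [remainder, sub_self, h1, Matrix.mul_one, expo, if_pos le_rfl] at h
  have e : (1 / 2 * (1 - 1 / 2) / (1 + 2 * c * (1 - 1 / 2)) : ℝ) = 1 / (4 * (1 + c)) := by
    field_simp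
    ring
  rwa [e] at h
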